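/- Let $B\ge 1$ and let $f:\mathbb{N}\to\mathbb{C}$ be a multiplicative function with $|f(n)|\le B$ for all $n$. For a positive integer $N$ and real $\alpha$ put $S(\alpha)=\sum_{n=1}^{N} f(n)e^{2\pi i n\alpha}$. Let $a$ and $q\ge 1$ be coprime integers with $|\alpha-a/q|\le q^{-2}$, and let $E\ge 4$ and $R>e$ be real numbers with $e^3/E\le R\le q\le N/R$. Then \[ |S(\alpha)|\le c_1(B,E,R)\,\frac{N}{\log N}+c_2(B,E,R,q)\,\frac{N(\log(ER))^{3/2}}{\sqrt{R}}, \] where, with $C$ the Euler--Mascheroni constant, \begin{align*} c_1(B,E,R)&=(1+2\pi)\,b_1(B,E)+2\pi B\,\frac{2\log R}{R^2},\\ c_2(B,E,R,q)&=(1+2\pi)\left(b_2(B,E)\,\frac{\left(e^{C}\log\log R+\frac{2.51}{\log\log R}\right)^{1/2}}{(\log(ER))^{3/2}}+b_3(B,E,R,q)\right),\\ b_1(B,E)&=B+9.82B^2+8.12(a_1+a_4)E+18.9a_3+3.46a_1+4.06a_4,\\ b_2(B,E)&=a_2\,\frac{\sqrt2\,E+1}{\log 2},\\ b_3(B,E,R,q)&=B^2\,\frac{7.63}{\sqrt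 E}\,\frac{\log(4ER)}{(\log(ER))^{3/2}}\left(1+\frac{\log(64/E)+1}{\log q}\right)+1.48a_5+\frac{1.48a_6}{\sqrt{\log(ER)}}\\ &\qquad+\frac{a_5}{\log 2}\,\frac{\log(2R)}{(\log(ER))^{3/2}}+\frac{a_6}{\log 2}\,\frac{1}{(\log(ER))^{3/2}}, \end{align*} and $a_1=1.59B^2$, $a_2=\frac{\pi^2}{6}zB^2$, $a_3=a_5=0.96\,zB^2$, $a_4=zB^2$, $a_6=1.32\,zB^2$, with \[ z=8\sqrt{2\prod_{p>2}\left(1+\frac{1}{p^3-p^2-2p}\right)}, \] the product running over the odd primes $p$. -/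

import Mathlib

namespace MontgomeryVaughan

noncomputable section

/-- `e(x) = exp(2πix)`. -/
def e (x : ℝ) : ℂ := Complex.exp (2 * Real.pi * Complex.I * x)

/-- The class `F` of multiplicative functions bounded by `B`. -/
def BoundedMultiplicative (B : ℝ) (f : ArithmeticFunction ℂ) : Prop :=
  f.IsMultiplicative ∧ ∀ n : ℕ, ‖f n‖ ≤ B

/-- `S(α) = ∑_{n=1}^N f(n) e(nα)`. -/
def S (f : ArithmeticFunction ℂ) (N : ℕ) (α : ℝ) : ℂ :=
  ∑ n ∈ Finset.Icc 1 N, f n * e (n * α)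

/-- The factor at `p` of the product `∏_{p>2} (1 + 1/(p³-p²-2p))` over the odd primes. -/
def oddPrimeFactor (p : {p : ℕ // p.Prime ∧ 2 < p}) : ℝ :=
  1 + 1 / ((p : ℝ) ^ 3 - (p : ℝ) ^ 2 - 2 * (p : ℝ))

/-- The infinite product below converges absolutely. -/
theorem multipliable_oddPrimeFactor : Multipliable oddPrimeFactor := by
  have key : ∀ p : {p : ℕ // p.Prime ∧ 2 < p},
      ((p : ℕ) : ℝ) ^ 2 / 3 ≤ (p : ℝ) ^ 3 - (p : ℝ) ^ 2 - 2 * (p : ℝ) := by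
    intro p
    have h : (3 : ℝ) ≤ ((p : ℕ) : ℝ) := by exact_mod_cast p.2.2
    nlinarith [mul_nonneg (sub_nonneg.2 h) (sq_nonneg ((p : ℕ) : ℝ)), sq_nonneg ((p : ℕ) : ℝ)]
  have hs : Summable fun p : {p : ℕ // p.Prime ∧ 2 < p} =>
      1 / ((p : ℝ) ^ 3 - (p : ℝ) ^ 2 - 2 * (p : ℝ)) := by
    have h2 : Summable fun p : {p : ℕ // p.Prime ∧ 2 < p} => 3 * (1 / ((p : ℕ) : ℝ) ^ 2) :=
      ((Real.summable_one_div_nat_pow.2 one_lt_two).subtype _).mul_left 3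
    refine Summable.of_nonneg_of_le (fun p => ?_) (fun p => ?_) h2
    · have hp : (0 : ℝ) < ((p : ℕ) : ℝ) := by exact_mod_cast p.2.1.pos
      have := key p
      exact one_div_nonneg.2 (le_trans (by positivity) this)
    · have hp : (0 : ℝ) < ((p : ℕ) : ℝ) := by exact_mod_cast p.2.1.pos
      calc _ ≤ 1 / (((p : ℕ) : ℝ) ^ 2 / 3) := one_div_le_one_div_of_le (by positivity) (key p)
        _ = _ := by field_simp
  exact Real.multipliable_one_add_of_summable hs

/-- `z = 8 √(2 ∏_{p>2} (1 + 1/(p³-p²-2p)))`. -/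
def z : ℝ := 8 * √(2 * ∏' p : {p : ℕ // p.Prime ∧ 2 < p}, oddPrimeFactor p)

def a₁ (B : ℝ) : ℝ := B ^ 2 * 1.59
def a₂ (B : ℝ) : ℝ := B ^ 2 * z * (Real.pi ^ 2 / 6)
def a₃ (B : ℝ) : ℝ := B ^ 2 * z * 0.96
def a₄ (B : ℝ) : ℝ := B ^ 2 * z
def a₅ (B : ℝ) : ℝ := B ^ 2 * z * 0.96
def a₆ (B : ℝ) : ℝ := B ^ 2 * 1.32 * z

def b₁ (B E : ℝ) : ℝ :=
  B + 9.82 * B ^ 2 + 8.12 * (a₁ B + a₄ B) * E + 18.9 * a₃ B + 3.46 * a₁ B + 4.06 * a₄ B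

def b₂ (B E : ℝ) : ℝ := a₂ B * ((√2 * E + 1) / Real.log 2)

def b₃ (B E R q : ℝ) : ℝ :=
  B ^ 2 * (7.63 / √E) * (Real.log (4 * E * R) / Real.log (E * R) ^ (3 / 2 : ℝ))
      * (1 + (Real.log (64 / E) + 1) / Real.log q)
    + a₅ B * 1.48
    + 1.48 * (a₆ B / √(Real.log (E * R)))
    + a₅ B / Real.log 2 * (Real.log (2 * R) / Real.log (E * R) ^ (3 / 2 : ℝ))
    + a₆ B / Real.log 2 * (1 / Real.log (E * R) ^ (3 / 2 : ℝ))

def c₁ (B E R : ℝ) : ℝ :=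
  (1 + 2 * Real.pi) * b₁ B E + B * (2 * Real.pi) * (2 * Real.log R / R ^ 2)

def c₂ (B E R q : ℝ) : ℝ :=
  (1 + 2 * Real.pi) *
    (b₂ B E *
        ((Real.exp Real.eulerMascheroniConstant * Real.log (Real.log R)
            + 2.51 / Real.log (Real.log R)) ^ (1 / 2 : ℝ)
          / Real.log (E * R) ^ (3 / 2 : ℝ))
      + b₃ B E R q)

end

end MontgomeryVaughan

/-!
Since `∑ n ≤ N, (log N - log n) ≤ N`, the sum `S(α) log N` differs by `O(N)` from
`∑ f(n) (log n) e(nα)`. Expanding `log = Λ * 1`, discarding the proper prime powers and replacing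
`f(pm)` by `f(p) f(m)` cost another `O(N)`, so that everything reduces to the bilinear sum
`∑ p ≤ N, ∑ m ≤ N / p, f(p) (log p) f(m) e(mpα)`.

The range of `p` is cut into the dyadic blocks `(P, 2P]`. On a block, Cauchy's inequality in `m`
removes the coefficients `f(m)` and leaves the geometric series
`∑ m, e(m(p - p')α) ≪ min(N / P, 1 / ‖(p - p')α‖)` over pairs of primes `p, p'`. Selberg's sieve
bounds the number of pairs with `p - p' = h` by `O(P / (log P)^2)` times the divisor sum
`∑ d ∣ h, 1 / d`, and the sum of the series over `h` is controlled by the spacing modulo one of the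
multiples of `α`, which is governed by `q`. Summation over the blocks yields a bound of the shape
`N / log N + N (log R) / √R`. The trivial bound `|S(α)| ≤ B N` already suffices unless `log N`
and `R` are large, and the constants `c₁` and `c₂` absorb all numerical losses, because `z > 11`.
-/

namespace MontgomeryVaughan

open Finset

section ChineseRemainder

lemma abs_card_Ioc_filter_modEq_sub_le {r a b : ℕ} (hr : 0 < r) (hab : a ≤ b) (v : ℕ) :
    |(#{n ∈ Ioc a b | n ≡ v [MOD r]} : ℝ) - (b - a : ℝ) / r| ≤ 1 := by
  have hcard := Nat.Ioc_filter_modEq_card a b hr v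
  have hmono : ⌊((a : ℚ) - v) / r⌋ ≤ ⌊((b : ℚ) - v) / r⌋ := by gcongr
  rw [max_eq_left (sub_nonneg.2 hmono)] at hcard
  have hsub : ((b : ℚ) - v) / r - (a - v) / r = (b - a) / r := by ring
  have hQ : |(#{n ∈ Ioc a b | n ≡ v [MOD r]} : ℚ) - (b - a : ℚ) / r| ≤ 1 := by
    rw [← Int.cast_natCast (R := ℚ), hcard, ← hsub, abs_le]
    push_cast
    have h₁ := Int.floor_le (((b : ℚ) - v) / r)
    have h₂ := Int.lt_floor_add_one (((b : ℚ) - v) / r)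
    have h₃ := Int.floor_le (((a : ℚ) - v) / r)
    have h₄ := Int.lt_floor_add_one (((a : ℚ) - v) / r)
    constructor <;> linarith
  simpa using (Rat.cast_le (K := ℝ)).2 hQ

lemma abs_sum_Ioc_zmod_sub_le {r a b : ℕ} [NeZero r] (hab : a ≤ b) (v : ZMod r → ℝ) :
    |∑ n ∈ Ioc a b, v n - (b - a) / r * ∑ x, v x| ≤ ∑ x, |v x| := by
  have hfiber : ∑ n ∈ Ioc a b, v n = ∑ x, #{n ∈ Ioc a b | n ≡ x.val [MOD r]} * v x := by
    rw [← sum_fiberwise (Ioc a b) (fun n => (n : ZMod r))]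
    refine sum_congr rfl fun x _ => ?_
    simp_rw [← ZMod.natCast_eq_natCast_iff, ZMod.natCast_zmod_val]
    rw [sum_congr rfl fun n hn => by rw [(mem_filter.1 hn).2], sum_const, nsmul_eq_mul]
  rw [hfiber, mul_sum, ← sum_sub_distrib]
  refine (abs_sum_le_sum_abs _ _).trans (sum_le_sum fun x _ => ?_)
  rw [← sub_mul, abs_mul]
  exact mul_le_of_le_one_left (abs_nonneg _)
    (abs_card_Ioc_filter_modEq_sub_le (NeZero.pos r) hab x.val)

lemma abs_sum_Ioc_prod_zmod_sub_le {ι : Type*} [Fintype ι] {m : ι → ℕ} [∀ i, NeZero (m i)]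
    (hm : Pairwise (Function.onFun Nat.Coprime m)) (u : ∀ i, ZMod (m i) → ℝ) {a b : ℕ}
    (hab : a ≤ b) :
    |∑ n ∈ Ioc a b, ∏ i, u i n - (b - a) * ∏ i, (∑ x, u i x) / m i| ≤ ∏ i, ∑ x, |u i x| := by
  classical
  have : NeZero (∏ i, m i) := ⟨prod_ne_zero_iff.2 fun i _ => NeZero.ne _⟩
  have hcrt (w : ∀ i, ZMod (m i) → ℝ) :
      ∑ x, ∏ i, w i (ZMod.prodEquivPi m hm x i) = ∏ i, ∑ x, w i x := by
    rw [prod_univ_sum, Fintype.piFinset_univ]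
    exact (ZMod.prodEquivPi m hm).toEquiv.sum_comp fun y => ∏ i, w i (y i)
  have h := abs_sum_Ioc_zmod_sub_le hab fun x => ∏ i, u i (ZMod.prodEquivPi m hm x i)
  simp_rw [abs_prod, hcrt, map_natCast, Pi.natCast_apply] at h
  rw [hcrt fun i x => |u i x|] at h
  convert h using 3
  rw [prod_div_distrib, Nat.cast_prod]
  ring

end ChineseRemainder

section SelbergSieve

variable {Ω : ∀ p : ℕ, Finset (ZMod p)}

/-- The density quotient `ω(p) / (p - ω(p))` of the sieve that removes the residue classes `Ω p`,
where `ω(p) = #(Ω p)`. -/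
noncomputable def sieveDensity (Ω : ∀ p : ℕ, Finset (ZMod p)) (p : ℕ) : ℝ := #(Ω p) / (p - #(Ω p))

/-- The function of mean zero modulo `p` that takes the value `-1` on the removed residue classes
and is constant on the others. -/
noncomputable def sieveLocal (Ω : ∀ p : ℕ, Finset (ZMod p)) (p : ℕ) (x : ZMod p) : ℝ :=
  if x ∈ Ω p then -1 else sieveDensity Ω p

/-- The multiplicative extension of `sieveLocal` to square-free moduli `d`. These functions of `n`
are nearly orthogonal on long intervals and constant on the sifted set. -/
noncomputable def sieveChar (Ω : ∀ p : ℕ, Finset (ZMod p)) (d n : ℕ) : ℝ :=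
  ∏ p ∈ d.primeFactors, sieveLocal Ω p n

/-- The multiplicative extension of `sieveDensity` to square-free moduli `d`. -/
noncomputable def sieveMass (Ω : ∀ p : ℕ, Finset (ZMod p)) (d : ℕ) : ℝ :=
  ∏ p ∈ d.primeFactors, sieveDensity Ω p

/-- The sum of `sieveMass` over the square-free `d ≤ Q`, the denominator in Selberg's sieve. -/
noncomputable def sieveTotal (Ω : ∀ p : ℕ, Finset (ZMod p)) (Q : ℕ) : ℝ :=
  ∑ d ∈ Icc 1 Q with Squarefree d, sieveMass Ω d

lemma sieveDensity_nonneg {p : ℕ} (hΩ : #(Ω p) < p) : 0 ≤ sieveDensity Ω p :=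
  div_nonneg (Nat.cast_nonneg _) (sub_nonneg.2 (by exact_mod_cast hΩ.le))

lemma sum_ite_mem_zmod {p : ℕ} [NeZero p] (A C : ℝ) :
    ∑ x, (if x ∈ Ω p then A else C) = #(Ω p) * A + (p - #(Ω p)) * C := by
  rw [sum_ite, sum_const, sum_const, nsmul_eq_mul, nsmul_eq_mul, filter_univ_mem,
    ← compl_filter, filter_univ_mem, card_compl, ZMod.card,
    Nat.cast_sub ((card_le_univ _).trans_eq (ZMod.card p))]

lemma sum_sieveLocal {p : ℕ} [NeZero p] (hΩ : #(Ω p) < p) : ∑ x, sieveLocal Ω p x = 0 := by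
  have hlt : (0 : ℝ) < p - #(Ω p) := sub_pos.2 (by exact_mod_cast hΩ)
  unfold sieveLocal
  rw [sum_ite_mem_zmod, sieveDensity, mul_div_cancel₀ _ hlt.ne']
  ring

lemma sum_sieveLocal_sq {p : ℕ} [NeZero p] (hΩ : #(Ω p) < p) :
    ∑ x, sieveLocal Ω p x ^ 2 = p * sieveDensity Ω p := by
  have hlt : (0 : ℝ) < p - #(Ω p) := sub_pos.2 (by exact_mod_cast hΩ)
  simp_rw [sieveLocal, ite_pow]
  rw [sum_ite_mem_zmod, sieveDensity]
  field_simp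
  ring

lemma abs_sieveLocal_le {p : ℕ} (hΩ : #(Ω p) < p) (x : ZMod p) : |sieveLocal Ω p x| ≤ p := by
  have hp : (1 : ℝ) ≤ p - #(Ω p) := by
    rw [le_sub_iff_add_le']
    exact_mod_cast hΩ
  unfold sieveLocal
  split_ifs
  · rw [abs_neg, abs_one]
    linarith [Nat.cast_nonneg (α := ℝ) #(Ω p)]
  · rw [abs_of_nonneg (sieveDensity_nonneg hΩ)]
    exact (div_le_self (Nat.cast_nonneg _) hp).trans (by exact_mod_cast hΩ.le)

lemma prod_ite_dvd_eq_prod_primeFactors {M : Type*} [CommMonoid M] {s : Finset ℕ}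
    (hs : ∀ p ∈ s, p.Prime) {d : ℕ} (hd : d ≠ 0) (hds : d.primeFactors ⊆ s) (g : ℕ → M) :
    ∏ p ∈ s, (if p ∣ d then g p else 1) = ∏ p ∈ d.primeFactors, g p := by
  rw [← prod_filter]
  congr 1
  ext p
  simp only [mem_filter, Nat.mem_primeFactors]
  exact ⟨fun h => ⟨hs p h.1, h.2, hd⟩, fun h => ⟨hds (Nat.mem_primeFactors.2 h), h.2.1⟩⟩

/-- The factor at `p` of `sieveChar Ω d`, extended by `1` to the primes that do not divide `d`. -/
noncomputable def sieveFactor (Ω : ∀ p : ℕ, Finset (ZMod p)) (d p : ℕ) (x : ZMod p) : ℝ :=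
  if p ∣ d then sieveLocal Ω p x else 1

lemma abs_sieveFactor_le {p : ℕ} (hΩ : #(Ω p) < p) (d : ℕ) (x : ZMod p) :
    |sieveFactor Ω d p x| ≤ if p ∣ d then (p : ℝ) else 1 := by
  unfold sieveFactor
  split_ifs
  · exact abs_sieveLocal_le hΩ x
  · exact abs_one.le

lemma sum_sieveFactor_mul_div {p : ℕ} [NeZero p] (hΩ : #(Ω p) < p) {d d' : ℕ}
    (hp : p ∣ d ∨ p ∣ d') :
    (∑ x, sieveFactor Ω d p x * sieveFactor Ω d' p x) / p
      = if p ∣ d ∧ p ∣ d' then sieveDensity Ω p else 0 := by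
  have hp0 : (p : ℝ) ≠ 0 := Nat.cast_ne_zero.2 (NeZero.ne p)
  simp only [sieveFactor]
  by_cases hd : p ∣ d <;> by_cases hd' : p ∣ d'
  · simp [hd, hd', ← sq, sum_sieveLocal_sq hΩ, hp0]
  · simp [hd, hd', sum_sieveLocal hΩ]
  · simp [hd, hd', sum_sieveLocal hΩ]
  · tauto

lemma prod_sum_sieveFactor_mul_div (hΩ : ∀ p, p.Prime → #(Ω p) < p) {d d' : ℕ}
    (hd : Squarefree d) (hd' : Squarefree d') [∀ i : (d * d').primeFactors, NeZero (i : ℕ)] :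
    ∏ i : (d * d').primeFactors, (∑ x, sieveFactor Ω d (i : ℕ) x * sieveFactor Ω d' i x) / (i : ℕ)
      = if d = d' then sieveMass Ω d else 0 := by
  have hdvd (p : ℕ) (hp : p ∈ (d * d').primeFactors) : p ∣ d ∨ p ∣ d' :=
    (Nat.prime_of_mem_primeFactors hp).dvd_mul.1 (Nat.dvd_of_mem_primeFactors hp)
  have hprime (p : ℕ) (hp : p ∈ (d * d').primeFactors) : #(Ω p) < p :=
    hΩ p (Nat.prime_of_mem_primeFactors hp)
  simp_rw [fun i : (d * d').primeFactors =>
    sum_sieveFactor_mul_div (hprime i i.2) (hdvd i i.2)]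
  rw [prod_coe_sort _ fun p => if p ∣ d ∧ p ∣ d' then sieveDensity Ω p else 0]
  split_ifs with hdd
  · subst hdd
    rw [Nat.primeFactors_mul hd.ne_zero hd.ne_zero, union_self]
    exact prod_congr rfl fun p hp => if_pos (by simpa using Nat.dvd_of_mem_primeFactors hp)
  · obtain ⟨p, hp⟩ : ∃ p, ¬ (p ∈ d.primeFactors ↔ p ∈ d'.primeFactors) := by
      by_contra! h
      exact hdd (by rw [← Nat.prod_primeFactors_of_squarefree hd, Finset.ext h,
        Nat.prod_primeFactors_of_squarefree hd'])
    refine prod_eq_zero (i := p) ?_ (if_neg fun h => hp ?_)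
    · rw [Nat.primeFactors_mul hd.ne_zero hd'.ne_zero, mem_union]
      tauto
    · have hpp : p.Prime := by
        by_contra hpp
        exact hp (by simp [hpp])
      simp [hpp, h, hd.ne_zero, hd'.ne_zero]

lemma sum_abs_sieveFactor_mul_le {p : ℕ} [NeZero p] (hΩ : #(Ω p) < p) {d d' : ℕ}
    (hp : p ∣ d ∨ p ∣ d') :
    ∑ x, |sieveFactor Ω d p x * sieveFactor Ω d' p x|
      ≤ ((if p ∣ d then (p : ℝ) else 1) * if p ∣ d' then (p : ℝ) else 1) ^ 2 := by
  set w : ℝ := (if p ∣ d then (p : ℝ) else 1) * if p ∣ d' then (p : ℝ) else 1 with hw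
  have hp1 : (1 : ℝ) ≤ p := Nat.one_le_cast.2 (NeZero.pos p)
  have hpw : (p : ℝ) ≤ w := by
    rw [hw]
    split_ifs <;> first | tauto | nlinarith
  calc ∑ x, |sieveFactor Ω d p x * sieveFactor Ω d' p x| ≤ ∑ _x : ZMod p, w := by
        refine sum_le_sum fun x _ => ?_
        rw [abs_mul]
        exact mul_le_mul (abs_sieveFactor_le hΩ d x) (abs_sieveFactor_le hΩ d' x) (abs_nonneg _)
          (by positivity)
    _ = p * w := by rw [sum_const, card_univ, ZMod.card, nsmul_eq_mul]
    _ ≤ w ^ 2 := by rw [sq]; gcongr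

lemma abs_sum_sieveChar_mul_sub_le (hΩ : ∀ p, p.Prime → #(Ω p) < p) {d d' : ℕ}
    (hd : Squarefree d) (hd' : Squarefree d') {a b : ℕ} (hab : a ≤ b) :
    |∑ n ∈ Ioc a b, sieveChar Ω d n * sieveChar Ω d' n
        - (b - a) * if d = d' then sieveMass Ω d else 0| ≤ ((d : ℝ) * d') ^ 2 := by
  have hprime (p : ℕ) (hp : p ∈ (d * d').primeFactors) : p.Prime := Nat.prime_of_mem_primeFactors hp
  have (i : (d * d').primeFactors) : NeZero (i : ℕ) := ⟨(hprime i i.2).ne_zero⟩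
  have hcop : Pairwise (Function.onFun Nat.Coprime fun i : (d * d').primeFactors => (i : ℕ)) :=
    fun i j hij => (Nat.coprime_primes (hprime i i.2) (hprime j j.2)).2 (Subtype.coe_ne_coe.2 hij)
  have hsub : d.primeFactors ⊆ (d * d').primeFactors ∧ d'.primeFactors ⊆ (d * d').primeFactors := by
    rw [Nat.primeFactors_mul hd.ne_zero hd'.ne_zero]
    exact ⟨subset_union_left, subset_union_right⟩
  have hchar (n : ℕ) : ∏ i : (d * d').primeFactors,
      sieveFactor Ω d i n * sieveFactor Ω d' i n = sieveChar Ω d n * sieveChar Ω d' n := by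
    rw [prod_coe_sort _ fun p : ℕ => sieveFactor Ω d p n * sieveFactor Ω d' p n, prod_mul_distrib]
    exact congr_arg₂ _ (prod_ite_dvd_eq_prod_primeFactors hprime hd.ne_zero hsub.1 _)
      (prod_ite_dvd_eq_prod_primeFactors hprime hd'.ne_zero hsub.2 _)
  have hnorm : ∏ i : (d * d').primeFactors,
      ∑ x : ZMod i, |sieveFactor Ω d i x * sieveFactor Ω d' i x| ≤ ((d : ℝ) * d') ^ 2 := by
    have hlocal (i : (d * d').primeFactors) := sum_abs_sieveFactor_mul_le (hΩ i (hprime i i.2))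
      ((hprime i i.2).dvd_mul.1 (Nat.dvd_of_mem_primeFactors i.2))
    refine (prod_le_prod (fun i _ => sum_nonneg fun x _ => abs_nonneg _)
      fun i _ => hlocal i).trans_eq ?_
    rw [prod_coe_sort _ fun p : ℕ =>
        ((if p ∣ d then (p : ℝ) else 1) * if p ∣ d' then (p : ℝ) else 1) ^ 2, prod_pow,
      prod_mul_distrib, prod_ite_dvd_eq_prod_primeFactors hprime hd.ne_zero hsub.1,
      prod_ite_dvd_eq_prod_primeFactors hprime hd'.ne_zero hsub.2, ← Nat.cast_prod,
      ← Nat.cast_prod, Nat.prod_primeFactors_of_squarefree hd,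
      Nat.prod_primeFactors_of_squarefree hd']
  have h := abs_sum_Ioc_prod_zmod_sub_le hcop
    (fun i (x : ZMod i) => sieveFactor Ω d i x * sieveFactor Ω d' i x) hab
  rw [prod_sum_sieveFactor_mul_div hΩ hd hd'] at h
  simp_rw [hchar] at h
  exact h.trans hnorm

lemma sum_sieveChar_eq_sieveTotal {Q n : ℕ}
    (hn : ∀ p, p.Prime → p ≤ Q → (n : ZMod p) ∉ Ω p) :
    ∑ d ∈ Icc 1 Q with Squarefree d, sieveChar Ω d n = sieveTotal Ω Q := by
  refine sum_congr rfl fun d hd => prod_congr rfl fun p hp => if_neg (hn p ?_ ?_)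
  · exact Nat.prime_of_mem_primeFactors hp
  · exact (Nat.le_of_mem_primeFactors hp).trans (mem_Icc.1 (mem_filter.1 hd).1).2

lemma sum_sum_sieveChar_sq_le (hΩ : ∀ p, p.Prime → #(Ω p) < p) (Q : ℕ) {a b : ℕ} (hab : a ≤ b) :
    ∑ n ∈ Ioc a b, (∑ d ∈ Icc 1 Q with Squarefree d, sieveChar Ω d n) ^ 2
      ≤ (b - a) * sieveTotal Ω Q + (Q : ℝ) ^ 6 := by
  set T := {d ∈ Icc 1 Q | Squarefree d} with hT
  have hQ (d : ℕ) (hd : d ∈ T) : (d : ℝ) ≤ Q := by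
    exact_mod_cast (mem_Icc.1 (mem_filter.1 hd).1).2
  have hcard : (#T : ℝ) ≤ Q := by
    exact_mod_cast (card_filter_le _ _).trans_eq (by rw [Nat.card_Icc, Nat.add_sub_cancel])
  calc ∑ n ∈ Ioc a b, (∑ d ∈ T, sieveChar Ω d n) ^ 2
      = ∑ d ∈ T, ∑ d' ∈ T, ∑ n ∈ Ioc a b, sieveChar Ω d n * sieveChar Ω d' n := by
        simp_rw [sq, sum_mul_sum]
        rw [sum_comm]
        exact sum_congr rfl fun d _ => sum_comm
    _ ≤ ∑ d ∈ T, ∑ d' ∈ T,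
          ((b - a) * (if d = d' then sieveMass Ω d else 0) + ((Q : ℝ) * Q) ^ 2) := by
        refine sum_le_sum fun d hd => sum_le_sum fun d' hd' => sub_le_iff_le_add'.1 ?_
        refine (le_of_abs_le (abs_sum_sieveChar_mul_sub_le hΩ (mem_filter.1 hd).2
          (mem_filter.1 hd').2 hab)).trans ?_
        have h₁ := hQ d hd
        have h₂ := hQ d' hd'
        gcongr
    _ = (b - a) * sieveTotal Ω Q + #T * (#T * ((Q : ℝ) * Q) ^ 2) := by
        simp_rw [sum_add_distrib, sum_const, nsmul_eq_mul, ← mul_sum, sum_ite_eq]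
        rw [sum_congr rfl fun d hd => if_pos hd, sieveTotal]
    _ ≤ (b - a) * sieveTotal Ω Q + Q * (Q * ((Q : ℝ) * Q) ^ 2) := by gcongr
    _ = _ := by ring

lemma one_le_sieveTotal (hΩ : ∀ p, p.Prime → #(Ω p) < p) {Q : ℕ} (hQ : 1 ≤ Q) :
    1 ≤ sieveTotal Ω Q := by
  have h := single_le_sum (f := sieveMass Ω) (s := {d ∈ Icc 1 Q | Squarefree d}) (a := 1)
    (fun d _ => prod_nonneg fun p hp =>
      sieveDensity_nonneg (hΩ p (Nat.prime_of_mem_primeFactors hp)))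
    (by simp [hQ])
  simpa [sieveTotal, sieveMass] using h

-- On `A` the sum of all `sieveChar`s is constantly `sieveTotal Ω Q`, and its second moment over the
-- interval is small by orthogonality.
lemma card_mul_sieveTotal_le (hΩ : ∀ p, p.Prime → #(Ω p) < p) {Q : ℕ} (hQ : 1 ≤ Q) {a b : ℕ}
    (hab : a ≤ b) {A : Finset ℕ} (hA : A ⊆ Ioc a b)
    (hsift : ∀ n ∈ A, ∀ p, p.Prime → p ≤ Q → (n : ZMod p) ∉ Ω p) :
    #A * sieveTotal Ω Q ≤ b - a + (Q : ℝ) ^ 6 := by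
  have hone := one_le_sieveTotal hΩ hQ
  set L := sieveTotal Ω Q
  have hsq : #A * L ^ 2 ≤ (b - a) * L + (Q : ℝ) ^ 6 := by
    refine le_trans ?_ (sum_sum_sieveChar_sq_le hΩ Q hab)
    rw [← nsmul_eq_mul, ← sum_const]
    refine (sum_le_sum fun n hn => ?_).trans
      (sum_le_sum_of_subset_of_nonneg hA fun _ _ _ => sq_nonneg _)
    rw [sum_sieveChar_eq_sieveTotal (hsift n hn)]
  refine le_of_mul_le_mul_right ?_ (by positivity : 0 < L)
  calc #A * L * L = #A * L ^ 2 := by ring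
    _ ≤ (b - a) * L + (Q : ℝ) ^ 6 * 1 := by rwa [mul_one]
    _ ≤ (b - a) * L + (Q : ℝ) ^ 6 * L := by gcongr
    _ = (b - a + (Q : ℝ) ^ 6) * L := by ring

end SelbergSieve

section SieveLowerBound

open UniqueFactorizationMonoid (radical radical_dvd_self squarefree_radical)

lemma sum_le_sum_of_forall_exists {ι κ : Type*} {S : Finset ι} {X : Finset κ} (g : κ → ι)
    {F : ι → ℝ} {G : κ → ℝ} (hG : ∀ x ∈ X, 0 ≤ G x)
    (h : ∀ n ∈ S, ∃ x ∈ X, g x = n ∧ F n ≤ G x) : ∑ n ∈ S, F n ≤ ∑ x ∈ X, G x := by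
  classical
  have hG' (n : ι) : ∀ x ∈ {x ∈ X | g x = n}, 0 ≤ G x := fun x hx => hG x (mem_filter.1 hx).1
  refine (sum_le_sum fun n hn => ?_).trans
    (sum_fiberwise_le_sum_of_sum_fiber_nonneg (g := g) fun n _ => sum_nonneg (hG' n))
  obtain ⟨x, hx, hgx, hF⟩ := h n hn
  exact hF.trans (single_le_sum (hG' n) (mem_filter.2 ⟨hx, hgx⟩))

lemma sum_primeFactors_subset_le {r : ℕ →* ℝ} (hr₀ : ∀ n, 0 ≤ r n)
    (hr₁ : ∀ p, p.Prime → r p < 1) (s : Finset ℕ) (Q : ℕ) :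
    ∑ n ∈ Icc 1 Q with n.primeFactors ⊆ s, r n ≤ ∏ p ∈ s with p.Prime, (1 - r p)⁻¹ := by
  have hsum := (EulerProduct.summable_and_hasSum_factoredNumbers_prod_filter_prime_geometric
    (f := r) (fun {p} hp => by rw [Real.norm_of_nonneg (hr₀ p)]; exact hr₁ p hp) s).2
  refine le_trans (le_of_eq ?_) (sum_le_hasSum {n ∈ Icc 1 Q | n.primeFactors ⊆ s}
    (fun n _ => Set.indicator_nonneg (fun n _ => hr₀ n) n) (hasSum_subtype_iff_indicator.1 hsum))
  refine sum_congr rfl fun n hn => (Set.indicator_of_mem ?_ _).symm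
  obtain ⟨hnQ, hns⟩ := mem_filter.1 hn
  exact Nat.mem_factoredNumbers_iff_primeFactors_subset.2
    ⟨Nat.one_le_iff_ne_zero.1 (mem_Icc.1 hnQ).1, hns⟩

lemma sum_radical_eq_le {r : ℕ →* ℝ} (hr₀ : ∀ n, 0 ≤ r n) (hr₁ : ∀ p, p.Prime → r p < 1) {d : ℕ}
    (hd : Squarefree d) (Q : ℕ) :
    ∑ n ∈ Icc 1 Q with radical n = d, r n ≤ ∏ p ∈ d.primeFactors, r p / (1 - r p) := by
  calc ∑ n ∈ Icc 1 Q with radical n = d, r n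
      ≤ ∑ m ∈ Icc 1 Q with m.primeFactors ⊆ d.primeFactors, r (d * m) := by
        refine sum_le_sum_of_forall_exists (d * ·) (fun m _ => hr₀ _) fun n hn => ?_
        obtain ⟨hnQ, hrad⟩ := mem_filter.1 hn
        obtain ⟨m, rfl⟩ : d ∣ n := hrad ▸ radical_dvd_self
        refine ⟨m, ?_, rfl, le_rfl⟩
        obtain ⟨hpos, hle⟩ := mem_Icc.1 hnQ
        have hm : 0 < m := Nat.pos_of_mul_pos_left hpos
        rw [mem_filter, mem_Icc]
        refine ⟨⟨hm, (Nat.le_mul_of_pos_left m hd.ne_zero.bot_lt).trans hle⟩, ?_⟩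
        conv_rhs => rw [← hrad, Nat.primeFactors_radical]
        exact Nat.primeFactors_mono (dvd_mul_left m d) (Nat.one_le_iff_ne_zero.1 hpos)
    _ = r d * ∑ m ∈ Icc 1 Q with m.primeFactors ⊆ d.primeFactors, r m := by
        simp_rw [map_mul, mul_sum]
    _ ≤ r d * ∏ p ∈ d.primeFactors with p.Prime, (1 - r p)⁻¹ :=
        mul_le_mul_of_nonneg_left (sum_primeFactors_subset_le hr₀ hr₁ _ Q) (hr₀ d)
    _ = ∏ p ∈ d.primeFactors, r p / (1 - r p) := by
        rw [filter_true_of_mem fun p hp => Nat.prime_of_mem_primeFactors hp]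
        nth_rw 1 [← Nat.prod_primeFactors_of_squarefree hd]
        simp_rw [map_prod, div_eq_mul_inv, prod_mul_distrib]

lemma sum_le_sum_squarefree_prod {r : ℕ →* ℝ} (hr₀ : ∀ n, 0 ≤ r n)
    (hr₁ : ∀ p, p.Prime → r p < 1) (Q : ℕ) :
    ∑ n ∈ Icc 1 Q, r n
      ≤ ∑ d ∈ Icc 1 Q with Squarefree d, ∏ p ∈ d.primeFactors, r p / (1 - r p) := by
  have hmaps : ∀ n ∈ Icc 1 Q, radical n ∈ {d ∈ Icc 1 Q | Squarefree d} := fun n hn => by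
    obtain ⟨hpos, hle⟩ := mem_Icc.1 hn
    exact mem_filter.2 ⟨mem_Icc.2 ⟨Nat.radical_pos n,
      (Nat.radical_le_self_iff.2 (Nat.one_le_iff_ne_zero.1 hpos)).trans hle⟩, squarefree_radical⟩
  rw [← sum_fiberwise_of_maps_to hmaps]
  exact sum_le_sum fun d hd => sum_radical_eq_le hr₀ hr₁ (mem_filter.1 hd).2 Q

/-- The completely multiplicative function with value `ω(p) / p` at `p`. -/
noncomputable def sieveRatio (Ω : ∀ p : ℕ, Finset (ZMod p)) : ℕ →* ℝ where
  toFun n := if n = 0 then 0 else (n.primeFactorsList.map fun p => (#(Ω p) / p : ℝ)).prod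
  map_one' := by simp
  map_mul' m n := by
    rcases eq_or_ne m 0 with rfl | hm
    · simp
    rcases eq_or_ne n 0 with rfl | hn
    · simp
    rw [if_neg (mul_ne_zero hm hn), if_neg hm, if_neg hn,
      ((Nat.perm_primeFactorsList_mul hm hn).map _).prod_eq, List.map_append, List.prod_append]

variable {Ω : ∀ p : ℕ, Finset (ZMod p)}

lemma sieveRatio_prime {p : ℕ} (hp : p.Prime) : sieveRatio Ω p = #(Ω p) / p := by
  simp [sieveRatio, hp.ne_zero, Nat.primeFactorsList_prime hp]

lemma sieveRatio_nonneg (n : ℕ) : 0 ≤ sieveRatio Ω n := by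
  change 0 ≤ if n = 0 then (0 : ℝ) else _
  split_ifs
  · exact le_rfl
  · refine List.prod_nonneg fun x hx => ?_
    obtain ⟨p, -, rfl⟩ := List.mem_map.1 hx
    positivity

lemma sum_sieveRatio_le_sieveTotal (hΩ : ∀ p, p.Prime → #(Ω p) < p) (Q : ℕ) :
    ∑ n ∈ Icc 1 Q, sieveRatio Ω n ≤ sieveTotal Ω Q := by
  refine (sum_le_sum_squarefree_prod sieveRatio_nonneg (fun p hp => ?_) Q).trans_eq
    (sum_congr rfl fun d _ => prod_congr rfl fun p hp => ?_)
  · rw [sieveRatio_prime hp, div_lt_one (by exact_mod_cast hp.pos)]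
    exact_mod_cast hΩ p hp
  · have hp := Nat.prime_of_mem_primeFactors hp
    have hp0 : (p : ℝ) ≠ 0 := by exact_mod_cast hp.ne_zero
    rw [sieveRatio_prime hp, sieveDensity, one_sub_div hp0, div_div_div_cancel_right₀ hp0]

end SieveLowerBound

section PrimePairs

/-- The residue classes modulo `p` excluded by the condition that `n` and `n + h` are both prime. -/
def primePairClasses (h p : ℕ) : Finset (ZMod p) := {0, -(h : ZMod p)}

lemma card_primePairClasses (h p : ℕ) : #(primePairClasses h p) = if p ∣ h then 1 else 2 := by
  unfold primePairClasses
  split_ifs with hp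
  · rw [(ZMod.natCast_eq_zero_iff h p).2 hp, neg_zero, pair_eq_singleton, card_singleton]
  · exact card_pair (neg_ne_zero.2 (mt (ZMod.natCast_eq_zero_iff h p).1 hp)).symm

lemma card_primePairClasses_lt {h p : ℕ} (hh : 2 ∣ h) (hp : p.Prime) :
    #(primePairClasses h p) < p := by
  rw [card_primePairClasses]
  split_ifs with hph
  · exact hp.one_lt
  · exact hp.two_le.lt_of_ne (by rintro rfl; exact hph hh)

lemma card_filter_coprime_divisors_le (h n : ℕ) :
    (#{b ∈ n.divisors | b.Coprime h} : ℝ) ≤ n * sieveRatio (primePairClasses h) n := by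
  induction n using induction_on_primes with
  | zero => simp
  | one => simpa using card_filter_le {1} fun b : ℕ => b.Coprime h
  | prime_mul p n hp ih =>
    have hp0 : (p : ℝ) ≠ 0 := by exact_mod_cast hp.ne_zero
    have hrec : ((p * n : ℕ) : ℝ) * sieveRatio (primePairClasses h) (p * n)
        = #(primePairClasses h p) * (n * sieveRatio (primePairClasses h) n) := by
      rw [map_mul, sieveRatio_prime hp, Nat.cast_mul]
      field_simp
    rw [hrec, card_primePairClasses]
    set D := {b ∈ n.divisors | b.Coprime h}
    have hsub : {b ∈ (p * n).divisors | b.Coprime h} ⊆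
        if p ∣ h then D else D ∪ D.image (p * ·) := by
      intro b hb
      obtain ⟨hdvd, hbh⟩ := mem_filter.1 hb
      obtain ⟨hdvd, hpn⟩ := Nat.mem_divisors.1 hdvd
      have hn : n ≠ 0 := right_ne_zero_of_mul hpn
      have hmem (hpb : Nat.Coprime b p) : b ∈ D :=
        mem_filter.2 ⟨Nat.mem_divisors.2 ⟨hpb.dvd_of_dvd_mul_left hdvd, hn⟩, hbh⟩
      split_ifs with hph
      · exact hmem (hbh.coprime_dvd_right hph)
      · by_cases hpb : p ∣ b
        · obtain ⟨c, rfl⟩ := hpb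
          exact mem_union_right _ (mem_image.2 ⟨c, mem_filter.2 ⟨Nat.mem_divisors.2
            ⟨Nat.dvd_of_mul_dvd_mul_left hp.pos hdvd, hn⟩, hbh.coprime_mul_left⟩, rfl⟩)
        · exact mem_union_left _ (hmem (hp.coprime_iff_not_dvd.2 hpb).symm)
    have hcard : #{b ∈ (p * n).divisors | b.Coprime h} ≤ (if p ∣ h then 1 else 2) * #D := by
      refine (card_le_card hsub).trans ?_
      split_ifs
      · rw [one_mul]
      · rw [two_mul]
        exact (card_union_le _ _).trans (add_le_add_right card_image_le _)
    calc (#{b ∈ (p * n).divisors | b.Coprime h} : ℝ) ≤ (if p ∣ h then 1 else 2 : ℕ) * #D := by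
          exact_mod_cast hcard
      _ ≤ _ := by gcongr

lemma sum_one_div_mul_sum_coprime_le (h y : ℕ) :
    (∑ a ∈ Icc 1 y, (1 : ℝ) / a) * (∑ b ∈ Icc 1 y with b.Coprime h, (1 : ℝ) / b)
      ≤ ∑ n ∈ Icc 1 (y ^ 2), sieveRatio (primePairClasses h) n := by
  set C := {b ∈ Icc 1 y | b.Coprime h} with hC
  have hmaps : ∀ x ∈ Icc 1 y ×ˢ C, x.1 * x.2 ∈ Icc 1 (y ^ 2) := by
    rintro ⟨a, b⟩ hx
    simp only [mem_product, hC, mem_filter, mem_Icc] at hx ⊢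
    obtain ⟨⟨ha, hay⟩, ⟨hb, hby⟩, -⟩ := hx
    exact ⟨Nat.mul_pos ha hb, by rw [sq]; exact Nat.mul_le_mul hay hby⟩
  rw [sum_mul_sum, ← sum_product', ← sum_fiberwise_of_maps_to hmaps]
  refine sum_le_sum fun n hn => ?_
  have hn₁ : 1 ≤ n := (mem_Icc.1 hn).1
  have : (0 : ℝ) < n := by exact_mod_cast hn₁
  set X := {x ∈ Icc 1 y ×ˢ C | x.1 * x.2 = n} with hX
  have hcard : #X ≤ #{b ∈ n.divisors | b.Coprime h} := by
    refine card_le_card_of_injOn Prod.snd (fun x hx => ?_) fun x hx x' hx' hxx => ?_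
    · simp only [hX, hC, coe_filter, Set.mem_ofPred_eq, mem_product, mem_filter] at hx ⊢
      exact ⟨Nat.mem_divisors.2 ⟨Dvd.intro_left _ hx.2, by omega⟩, hx.1.2.2⟩
    · simp only [hX, coe_filter, Set.mem_ofPred_eq] at hx hx'
      have hx0 : 0 < x.2 := Nat.pos_of_mul_pos_left (hx.2 ▸ hn₁)
      exact Prod.ext (Nat.eq_of_mul_eq_mul_right hx0 (by rw [hx.2, hxx, hx'.2])) hxx
  calc ∑ x ∈ X, (1 : ℝ) / x.1 * (1 / x.2) = ∑ _x ∈ X, (1 : ℝ) / n := by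
        refine sum_congr rfl fun x hx => ?_
        rw [← (mem_filter.1 hx).2, Nat.cast_mul, one_div_mul_one_div]
    _ = #X * (1 / n) := by rw [sum_const, nsmul_eq_mul]
    _ ≤ n * sieveRatio (primePairClasses h) n * (1 / n) := by
        gcongr
        exact le_trans (by exact_mod_cast hcard) (card_filter_coprime_divisors_le h n)
    _ = sieveRatio (primePairClasses h) n := by field_simp

lemma exists_mul_eq_coprime {h n : ℕ} (hh : h ≠ 0) (hn : n ≠ 0) :
    ∃ k b, k * b = n ∧ k.primeFactors ⊆ h.primeFactors ∧ b.Coprime h := by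
  induction n using induction_on_primes with
  | zero => exact absurd rfl hn
  | one => exact ⟨1, 1, rfl, by simp, by simp⟩
  | prime_mul p n hp ih =>
    obtain ⟨k, b, rfl, hk, hb⟩ := ih (right_ne_zero_of_mul hn)
    by_cases hph : p ∣ h
    · refine ⟨p * k, b, mul_assoc p k b, ?_, hb⟩
      rw [Nat.primeFactors_mul hp.ne_zero (by rintro rfl; simp at hn), hp.primeFactors]
      exact union_subset (singleton_subset_iff.2 (Nat.mem_primeFactors.2 ⟨hp, hph, hh⟩)) hk
    · exact ⟨k, p * b, mul_left_comm k p b, hk,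
        (hp.coprime_iff_not_dvd.2 hph).mul_left hb⟩

/-- The sum `∑_{d ∣ h} 1/d`, which majorises the singular series of the prime pairs `n, n + h`. -/
noncomputable def invDivisorSum (h : ℕ) : ℝ := ∑ d ∈ h.divisors, (1 : ℝ) / d

lemma invDivisorSum_nonneg (h : ℕ) : 0 ≤ invDivisorSum h := sum_nonneg fun _ _ => by positivity

lemma sum_primeFactors_subset_one_div_le {h : ℕ} (hh : h ≠ 0) (y : ℕ) :
    ∑ k ∈ Icc 1 y with k.primeFactors ⊆ h.primeFactors, (1 : ℝ) / k ≤ 2 * invDivisorSum h := by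
  calc ∑ k ∈ Icc 1 y with k.primeFactors ⊆ h.primeFactors, (1 : ℝ) / k
      ≤ ∑ x ∈ Ioo 0 (y + 1) ×ˢ h.divisors, ((x.1 : ℝ) ^ 2)⁻¹ * (1 / (x.2 : ℝ)) := by
        refine sum_le_sum_of_forall_exists (fun x => x.1 ^ 2 * x.2) (fun x _ => by positivity)
          fun k hk => ?_
        obtain ⟨hky, hkh⟩ := mem_filter.1 hk
        obtain ⟨hk₁, hky⟩ := mem_Icc.1 hky
        obtain ⟨d, m, hdm, hd⟩ := Nat.sq_mul_squarefree k
        have hm : 0 < m := Nat.pos_of_ne_zero (by rintro rfl; simp at hdm; omega)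
        have hmk : m ≤ k := by nlinarith [hd.ne_zero.bot_lt, Nat.le_self_pow two_ne_zero m]
        have hdk : d.primeFactors ⊆ k.primeFactors :=
          Nat.primeFactors_mono (hdm ▸ dvd_mul_left d (m ^ 2)) (by omega)
        have hdh : d ∣ h := by
          rw [← Nat.prod_primeFactors_of_squarefree hd, Nat.prod_primeFactors_dvd_iff hh]
          exact hdk.trans hkh
        refine ⟨(m, d), mem_product.2 ⟨mem_Ioo.2 ⟨hm, by omega⟩, Nat.mem_divisors.2 ⟨hdh, hh⟩⟩,
          hdm, ?_⟩
        rw [← hdm, Nat.cast_mul, Nat.cast_pow, one_div, one_div, mul_inv]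
    _ = (∑ m ∈ Ioo 0 (y + 1), ((m : ℝ) ^ 2)⁻¹) * invDivisorSum h := by
        rw [invDivisorSum, sum_mul_sum, ← sum_product']
    _ ≤ 2 * invDivisorSum h := by
        refine mul_le_mul_of_nonneg_right ?_ (invDivisorSum_nonneg h)
        simpa using sum_Ioo_inv_sq_le (α := ℝ) 0 (y + 1)

lemma sum_one_div_le_coprime_mul_primeFactors_subset {h : ℕ} (hh : h ≠ 0) (y : ℕ) :
    ∑ n ∈ Icc 1 y, (1 : ℝ) / n ≤ (∑ b ∈ Icc 1 y with b.Coprime h, (1 : ℝ) / b)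
      * ∑ k ∈ Icc 1 y with k.primeFactors ⊆ h.primeFactors, (1 : ℝ) / k := by
  rw [sum_mul_sum, ← sum_product']
  refine sum_le_sum_of_forall_exists (fun x => x.2 * x.1) (fun x _ => by positivity)
    fun n hn => ?_
  obtain ⟨hn₁, hny⟩ := mem_Icc.1 hn
  obtain ⟨k, b, rfl, hk, hb⟩ := exists_mul_eq_coprime hh (n := n) (by omega)
  have hk₀ : 0 < k := Nat.pos_of_mul_pos_right hn₁
  have hb₀ : 0 < b := Nat.pos_of_mul_pos_left hn₁
  refine ⟨(b, k), ?_, rfl, ?_⟩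
  · simp only [mem_product, mem_filter, mem_Icc]
    exact ⟨⟨⟨hb₀, (Nat.le_mul_of_pos_left b hk₀).trans hny⟩, hb⟩,
      ⟨hk₀, (Nat.le_mul_of_pos_right k hb₀).trans hny⟩, hk⟩
  · rw [Nat.cast_mul, one_div_mul_one_div, mul_comm]

lemma log_add_one_sq_le_sieveTotal_mul {h : ℕ} (hh : 2 ∣ h) (hh₀ : h ≠ 0) (y : ℕ) :
    Real.log (y + 1) ^ 2 ≤ sieveTotal (primePairClasses h) (y ^ 2) * (2 * invDivisorSum h) := by
  have hlog : Real.log (y + 1) ≤ ∑ n ∈ Icc 1 y, (1 : ℝ) / n := by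
    simpa [harmonic_eq_sum_Icc] using log_add_one_le_harmonic y
  have hlog₀ : 0 ≤ Real.log ((y : ℝ) + 1) := by exact_mod_cast Real.log_natCast_nonneg (y + 1)
  have hcop := (sum_one_div_le_coprime_mul_primeFactors_subset hh₀ y).trans
    (mul_le_mul_of_nonneg_left (sum_primeFactors_subset_one_div_le hh₀ y)
      (sum_nonneg fun _ _ => by positivity))
  have htotal := (sum_one_div_mul_sum_coprime_le h y).trans
    (sum_sieveRatio_le_sieveTotal (fun p => card_primePairClasses_lt hh) (y ^ 2))
  set H := ∑ n ∈ Icc 1 y, (1 : ℝ) / n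
  set C := ∑ b ∈ Icc 1 y with b.Coprime h, (1 : ℝ) / b
  have hs := invDivisorSum_nonneg h
  have : 0 ≤ H := hlog₀.trans hlog
  calc Real.log (y + 1) ^ 2 ≤ H * H := by rw [sq]; gcongr
    _ ≤ H * (C * (2 * invDivisorSum h)) := by gcongr
    _ = (H * C) * (2 * invDivisorSum h) := by ring
    _ ≤ _ := by gcongr

lemma natCast_notMem_primePairClasses {h n p : ℕ} (hn : n.Prime) (hnh : (n + h).Prime)
    (hp : p.Prime) (hpn : p < n) : (n : ZMod p) ∉ primePairClasses h p := by
  rw [primePairClasses, mem_insert, mem_singleton, ZMod.natCast_eq_zero_iff,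
    eq_neg_iff_add_eq_zero, ← Nat.cast_add, ZMod.natCast_eq_zero_iff,
    Nat.prime_dvd_prime_iff_eq hp hn, Nat.prime_dvd_prime_iff_eq hp hnh]
  omega

lemma filter_prime_pairs_eq_empty {h P : ℕ} (hh : ¬ 2 ∣ h) (hP : 1 < P) :
    {n ∈ Ioc P (2 * P) | n.Prime ∧ (n + h).Prime} = ∅ :=
  filter_eq_empty_iff.2 fun n hn ⟨hn₁, hn₂⟩ => by
    have := (mem_Ioc.1 hn).1
    have := hn₁.eq_two_or_odd
    have := hn₂.eq_two_or_odd
    omega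

lemma card_prime_pairs_mul_sieveTotal_le {h P y : ℕ} (hh : 2 ∣ h) (hy : 1 ≤ y)
    (hyP : y ^ 12 ≤ P) :
    #{n ∈ Ioc P (2 * P) | n.Prime ∧ (n + h).Prime} * sieveTotal (primePairClasses h) (y ^ 2)
      ≤ 2 * P := by
  have hpow : ((y ^ 2 : ℕ) : ℝ) ^ 6 ≤ P := by
    rw [Nat.cast_pow, ← pow_mul]
    exact_mod_cast hyP
  refine (card_mul_sieveTotal_le (fun p => card_primePairClasses_lt hh)
    (Nat.one_le_pow _ _ hy) (by omega : P ≤ 2 * P) (filter_subset _ _)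
    fun n hn p hp hpQ => ?_).trans ?_
  · obtain ⟨hn, hn₁, hn₂⟩ := mem_filter.1 hn
    exact natCast_notMem_primePairClasses hn₁ hn₂ hp ((hpQ.trans
      ((Nat.pow_le_pow_right hy (by norm_num)).trans hyP)).trans_lt (mem_Ioc.1 hn).1)
  · push_cast at hpow ⊢
    linarith

lemma card_prime_pairs_mul_log_sq_le {h P : ℕ} (hh : h ≠ 0) (hP : 1 ≤ P) :
    #{n ∈ Ioc P (2 * P) | n.Prime ∧ (n + h).Prime} * Real.log P ^ 2
      ≤ 576 * P * invDivisorSum h := by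
  set A := {n ∈ Ioc P (2 * P) | n.Prime ∧ (n + h).Prime} with hA
  have hs := invDivisorSum_nonneg h
  rcases hP.eq_or_lt with rfl | hP₁
  · simpa using hs
  by_cases heven : 2 ∣ h
  swap
  · rw [hA, filter_prime_pairs_eq_empty heven hP₁, card_empty, Nat.cast_zero, zero_mul]
    positivity
  set y := Nat.nthRoot 12 P
  have hy : y ^ 12 ≤ P := Nat.pow_nthRoot_le (.inl (by norm_num))
  have hy₁ : 1 ≤ y := (Nat.le_nthRoot_iff (by norm_num)).2 (by simpa)
  have hlog : Real.log P ≤ 12 * Real.log (y + 1) := by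
    rw [← Nat.cast_ofNat, ← Real.log_pow]
    exact Real.log_le_log (by exact_mod_cast hP)
      (by exact_mod_cast (Nat.lt_pow_nthRoot_add_one (by norm_num) P).le)
  have hsieve : #A * sieveTotal (primePairClasses h) (y ^ 2) ≤ 2 * P :=
    card_prime_pairs_mul_sieveTotal_le heven hy₁ hy
  have hlog₀ : 0 ≤ Real.log P := Real.log_natCast_nonneg P
  calc #A * Real.log P ^ 2 ≤ #A * (12 * Real.log (y + 1)) ^ 2 := by gcongr
    _ = 144 * (#A * Real.log (y + 1) ^ 2) := by ring
    _ ≤ 144 * (#A * (sieveTotal (primePairClasses h) (y ^ 2) * (2 * invDivisorSum h))) := by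
        gcongr
        exact log_add_one_sq_le_sieveTotal_mul heven hh y
    _ = 288 * invDivisorSum h * (#A * sieveTotal (primePairClasses h) (y ^ 2)) := by ring
    _ ≤ 288 * invDivisorSum h * (2 * P) := by gcongr
    _ = _ := by ring

end PrimePairs

section ExponentialSums

lemma norm_e (x : ℝ) : ‖e x‖ = 1 := by
  have h : 2 * (Real.pi : ℂ) * Complex.I * x = ((2 * Real.pi * x : ℝ) : ℂ) * Complex.I := by
    push_cast; ring
  rw [e, h, Complex.norm_exp_ofReal_mul_I]

lemma e_add (x y : ℝ) : e (x + y) = e x * e y := by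
  rw [e, e, e, ← Complex.exp_add]
  push_cast
  ring_nf

lemma e_nat_mul (m : ℕ) (x : ℝ) : e (m * x) = e x ^ m := by
  rw [e, e, ← Complex.exp_nat_mul]
  push_cast
  ring_nf

lemma conj_e (x : ℝ) : starRingEnd ℂ (e x) = e (-x) := by
  rw [e, e, ← Complex.exp_conj]
  simp only [map_mul, Complex.conj_ofReal, Complex.conj_I, map_ofNat]
  push_cast
  ring_nf

lemma four_mul_norm_coe_le_norm_e_sub_one (x : ℝ) :
    4 * ‖(x : UnitAddCircle)‖ ≤ ‖e x - 1‖ := by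
  have he : e x = Complex.exp (Complex.I * ((2 * Real.pi * x : ℝ) : ℂ)) := by
    rw [e]
    push_cast
    ring_nf
  have hsin : |Real.sin (Real.pi * x)| = |Real.sin (Real.pi * (x - round x))| := by
    have hshift : Real.pi * (x - round x) = Real.pi * x - (round x : ℤ) * Real.pi := by ring
    rw [hshift, Real.sin_sub_int_mul_pi, abs_mul, abs_zpow, abs_neg, abs_one, one_zpow, one_mul]
  have habs : |Real.pi * (x - round x)| = Real.pi * ‖(x : UnitAddCircle)‖ := by
    rw [abs_mul, abs_of_pos Real.pi_pos, UnitAddCircle.norm_eq]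
  have hjordan := Real.mul_abs_le_abs_sin (x := Real.pi * (x - round x)) <| by
    rw [habs, UnitAddCircle.norm_eq]
    nlinarith [abs_sub_round x, Real.pi_pos]
  rw [habs, ← hsin, ← mul_assoc, div_mul_cancel₀ _ Real.pi_ne_zero] at hjordan
  rw [he, Complex.norm_exp_I_mul_ofReal_sub_one, mul_assoc, mul_div_cancel_left₀ _ two_ne_zero,
    Real.norm_eq_abs, abs_mul, abs_two]
  linarith

/-- A smooth substitute for `min (2 * M) (1 / ‖u‖)`, where `‖u‖` is the distance from `u` to the
nearest integer: it bounds a sum of `e (m * u)` over at most `M` consecutive integers `m`. -/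
noncomputable def geomBound (M : ℝ) (u : UnitAddCircle) : ℝ := 2 / (1 / M + 2 * ‖u‖)

lemma geomBound_nonneg {M : ℝ} (hM : 0 < M) (u : UnitAddCircle) : 0 ≤ geomBound M u := by
  unfold geomBound
  positivity

lemma geomBound_le {M : ℝ} (hM : 0 < M) (u : UnitAddCircle) : geomBound M u ≤ 2 * M := by
  unfold geomBound
  rw [div_le_iff₀ (by positivity), mul_add, mul_assoc 2 M, mul_one_div_cancel hM.ne']
  have : 0 ≤ 2 * M * (2 * ‖u‖) := by positivity
  linarith

lemma geomBound_neg (M : ℝ) (u : UnitAddCircle) : geomBound M (-u) = geomBound M u := by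
  rw [geomBound, geomBound, norm_neg]

lemma norm_sum_Icc_e_le {M : ℝ} (hM : 0 < M) {K : ℕ} (hK : (K : ℝ) ≤ M) (x : ℝ) :
    ‖∑ m ∈ Icc 1 K, e (m * x)‖ ≤ geomBound M x := by
  set A := ‖∑ m ∈ Icc 1 K, e (m * x)‖
  have htriv : A ≤ M := by
    refine (norm_sum_le _ _).trans (le_trans (le_of_eq ?_) hK)
    simp [norm_e]
  have hgeom : A * ‖e x - 1‖ ≤ 2 := by
    have hsum : ∑ m ∈ Icc 1 K, e (m * x) = e x * ∑ i ∈ range K, e x ^ i := by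
      rw [← Ico_add_one_right_eq_Icc, sum_Ico_eq_sum_range, mul_sum]
      refine sum_congr (by simp) fun i _ => ?_
      rw [e_nat_mul, pow_add, pow_one]
    rw [← norm_mul, hsum, mul_assoc, geom_sum_mul, norm_mul, norm_e, one_mul]
    refine (norm_sub_le _ _).trans ?_
    rw [norm_pow, norm_e]
    norm_num
  have hA : A * (4 * ‖(x : UnitAddCircle)‖) ≤ 2 :=
    (mul_le_mul_of_nonneg_left (four_mul_norm_coe_le_norm_e_sub_one x) (norm_nonneg _)).trans hgeom
  have hM' : A * (1 / M) ≤ 1 := by rwa [mul_one_div, div_le_one hM]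
  rw [geomBound, le_div_iff₀ (by positivity)]
  linarith

end ExponentialSums

section WellSpaced

lemma exists_coe_eq_and_abs_eq_norm (u : UnitAddCircle) :
    ∃ t : ℝ, (t : UnitAddCircle) = u ∧ |t| = ‖u‖ := by
  induction u using QuotientAddGroup.induction_on with
  | H x =>
    refine ⟨x - round x, ?_, UnitAddCircle.norm_eq.symm⟩
    have hround : ((round x : ℝ) : UnitAddCircle) = 0 :=
      (AddCircle.coe_eq_zero_iff 1).2 ⟨round x, by simp⟩
    rw [AddCircle.coe_sub, hround, sub_zero]

lemma norm_coe_le_abs (t : ℝ) : ‖(t : UnitAddCircle)‖ ≤ |t| := by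
  rw [UnitAddCircle.norm_eq]
  simpa using round_le t 0

variable {ι : Type*} {H : Finset ι} {x : ι → UnitAddCircle} {δ : ℝ}

lemma card_filter_floor_norm_div_eq_le_two (hδ : 0 < δ)
    (hx : (H : Set ι).Pairwise fun i j => δ ≤ dist (x i) (x j)) (k : ℕ) :
    #{i ∈ H | ⌊‖x i‖ / δ⌋₊ = k} ≤ 2 := by
  choose t ht habs using fun i => exists_coe_eq_and_abs_eq_norm (x i)
  have hmem : ∀ i, ⌊‖x i‖ / δ⌋₊ = k → k * δ ≤ |t i| ∧ |t i| < (k + 1) * δ := fun i hi => by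
    rw [habs, ← le_div_iff₀ hδ, ← div_lt_iff₀ hδ]
    exact (Nat.floor_eq_iff (by positivity)).1 hi
  -- Two points of the same cell lying on the same side of `0` are closer than `δ`.
  refine card_le_card_of_injOn (t := (univ : Finset Bool)) (fun i => decide (0 ≤ t i))
    (fun _ _ => mem_coe.2 (mem_univ _)) fun i hi j hj hij => ?_
  obtain ⟨hiH, hik⟩ := mem_filter.1 hi
  obtain ⟨hjH, hjk⟩ := mem_filter.1 hj
  by_contra hne
  have hdist : δ ≤ |t i - t j| := by
    refine (hx hiH hjH hne).trans ?_
    rw [← ht i, ← ht j, dist_eq_norm, ← AddCircle.coe_sub]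
    exact norm_coe_le_abs _
  have hi' := hmem i hik
  have hj' := hmem j hjk
  rw [decide_eq_decide] at hij
  rcases le_or_gt 0 (t i) with h | h
  · rw [abs_of_nonneg h] at hi'
    rw [abs_of_nonneg (hij.1 h)] at hj'
    exact hdist.not_gt (abs_lt.2 ⟨by linarith, by linarith⟩)
  · rw [abs_of_neg h] at hi'
    rw [abs_of_neg (not_le.1 (mt hij.2 h.not_ge))] at hj'
    exact hdist.not_gt (abs_lt.2 ⟨by linarith, by linarith⟩)

lemma sum_floor_norm_div_le (hδ : 0 < δ)
    (hx : (H : Set ι).Pairwise fun i j => δ ≤ dist (x i) (x j)) {K : Finset ℕ}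
    (hK : ∀ i ∈ H, ⌊‖x i‖ / δ⌋₊ ∈ K) {ψ : ℕ → ℝ} (hψ : ∀ k, 0 ≤ ψ k) :
    ∑ i ∈ H, ψ ⌊‖x i‖ / δ⌋₊ ≤ 2 * ∑ k ∈ K, ψ k := by
  rw [← sum_fiberwise_of_maps_to' hK, mul_sum]
  gcongr with k _
  rw [sum_const, nsmul_eq_mul]
  gcongr
  · exact hψ k
  · exact_mod_cast card_filter_floor_norm_div_eq_le_two hδ hx k

lemma geomBound_le_floor (hδ : 0 < δ) {M : ℝ} (hM : 0 < M) (u : UnitAddCircle) :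
    geomBound M u ≤ δ⁻¹ / (1 / (2 * M * δ) + ⌊‖u‖ / δ⌋₊) := by
  have hfloor : ⌊‖u‖ / δ⌋₊ * δ ≤ ‖u‖ :=
    (le_div_iff₀ hδ).1 (Nat.floor_le (by positivity))
  calc geomBound M u ≤ 2 / (1 / M + 2 * (⌊‖u‖ / δ⌋₊ * δ)) := by
        unfold geomBound
        gcongr
    _ = _ := by field_simp

lemma sum_one_div_add_le {y : ℝ} (hy : 0 < y) (n : ℕ) :
    ∑ k ∈ Icc 1 n, 1 / (y + k) ≤ Real.log (1 + n / y) := by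
  induction n with
  | zero => simp
  | succ n ih =>
    have hratio : 1 + ((n + 1 : ℕ) : ℝ) / y = (1 + n / y) * ((y + (n + 1)) / (y + n)) := by
      push_cast
      field_simp
    have hlog := Real.one_sub_inv_le_log_of_pos (by positivity : 0 < (y + ((n : ℝ) + 1)) / (y + n))
    have hterm : 1 - ((y + ((n : ℝ) + 1)) / (y + n))⁻¹ = 1 / (y + ((n + 1 : ℕ) : ℝ)) := by
      push_cast
      field_simp
      ring_nf
    rw [sum_Icc_succ_top (by omega), hratio, Real.log_mul (by positivity) (by positivity)]
    linarith

lemma sum_inv_div_add_le (hδ : 0 < δ) {M : ℝ} (hM : 0 < M) (n : ℕ) :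
    ∑ k ∈ Icc 1 n, δ⁻¹ / (1 / (2 * M * δ) + k) ≤ δ⁻¹ * Real.log (1 + 2 * n * M * δ) := by
  have hlog := sum_one_div_add_le (by positivity : 0 < 1 / (2 * M * δ)) n
  calc ∑ k ∈ Icc 1 n, δ⁻¹ / (1 / (2 * M * δ) + k)
      = δ⁻¹ * ∑ k ∈ Icc 1 n, 1 / (1 / (2 * M * δ) + k) := by simp only [mul_sum, mul_one_div]
    _ ≤ δ⁻¹ * Real.log (1 + n / (1 / (2 * M * δ))) := by gcongr
    _ = δ⁻¹ * Real.log (1 + 2 * n * M * δ) := by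
        rw [div_div_eq_mul_div]
        ring_nf

lemma sum_geomBound_le_of_pairwise_le_dist (hδ : 0 < δ)
    (hx : (H : Set ι).Pairwise fun i j => δ ≤ dist (x i) (x j)) {M : ℝ} (hM : 0 < M) :
    ∑ i ∈ H, geomBound M (x i) ≤ 4 * M + 2 * δ⁻¹ * Real.log (1 + M) := by
  set n := ⌊1 / (2 * δ)⌋₊
  set ψ : ℕ → ℝ := fun k => δ⁻¹ / (1 / (2 * M * δ) + k)
  have hn : 2 * n * M * δ ≤ M := by
    have : n * (2 * δ) ≤ 1 := (le_div_iff₀ (by positivity)).1 (Nat.floor_le (by positivity))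
    nlinarith
  have hcell : ∀ i ∈ H, ⌊‖x i‖ / δ⌋₊ ∈ range (n + 1) := fun i _ => by
    have hhalf : ‖x i‖ ≤ 1 / 2 := by
      simpa using AddCircle.norm_le_half_period 1 (x := x i) one_ne_zero
    refine mem_range.2 (Nat.lt_succ_of_le (Nat.floor_le_floor ?_))
    calc ‖x i‖ / δ ≤ 1 / 2 / δ := by gcongr
      _ = 1 / (2 * δ) := by rw [div_div]
  have hψ : ∑ k ∈ range (n + 1), ψ k = 2 * M + ∑ k ∈ Icc 1 n, ψ k := by
    rw [range_eq_Ico, sum_eq_sum_Ico_succ_bot (by omega), Ico_add_one_right_eq_Icc]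
    congr 1
    simp only [ψ, Nat.cast_zero, add_zero]
    field_simp
  calc ∑ i ∈ H, geomBound M (x i) ≤ ∑ i ∈ H, ψ ⌊‖x i‖ / δ⌋₊ :=
        sum_le_sum fun i _ => geomBound_le_floor hδ hM (x i)
    _ ≤ 2 * ∑ k ∈ range (n + 1), ψ k :=
        sum_floor_norm_div_le hδ hx hcell fun k => by positivity
    _ ≤ 2 * (2 * M + δ⁻¹ * Real.log (1 + 2 * n * M * δ)) := by
        rw [hψ]
        gcongr
        exact sum_inv_div_add_le hδ hM n
    _ ≤ 2 * (2 * M + δ⁻¹ * Real.log (1 + M)) := by gcongr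
    _ = 4 * M + 2 * δ⁻¹ * Real.log (1 + M) := by ring

lemma sum_geomBound_le_of_le_norm (hδ : 0 < δ)
    (hx : (H : Set ι).Pairwise fun i j => δ ≤ dist (x i) (x j)) (hx₀ : ∀ i ∈ H, δ ≤ ‖x i‖)
    {M : ℝ} (hM : 0 < M) :
    ∑ i ∈ H, geomBound M (x i) ≤ δ⁻¹ + 2 * δ⁻¹ * Real.log (1 + 2 * #H * M * δ) := by
  set ψ : ℕ → ℝ := fun k => δ⁻¹ / (1 / (2 * M * δ) + k)
  have hle : ∀ i ∈ H, geomBound M (x i) ≤ ψ ⌊‖x i‖ / δ⌋₊ := fun i _ =>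
    geomBound_le_floor hδ hM (x i)
  have hfar : ∑ i ∈ H with ¬ ⌊‖x i‖ / δ⌋₊ ≤ #H, geomBound M (x i) ≤ δ⁻¹ := by
    calc ∑ i ∈ H with ¬ ⌊‖x i‖ / δ⌋₊ ≤ #H, geomBound M (x i)
        ≤ ∑ i ∈ H with ¬ ⌊‖x i‖ / δ⌋₊ ≤ #H, δ⁻¹ / #H := by
          refine sum_le_sum fun i hi => ?_
          obtain ⟨hiH, hfloor⟩ := mem_filter.1 hi
          have hpos : 0 < #H := card_pos.2 ⟨i, hiH⟩
          have hcast : (#H : ℝ) ≤ ⌊‖x i‖ / δ⌋₊ := by exact_mod_cast (not_le.1 hfloor).le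
          refine (hle i hiH).trans (div_le_div_of_nonneg_left (by positivity) (by positivity) ?_)
          linarith [show 0 ≤ 1 / (2 * M * δ) by positivity]
      _ ≤ #H * (δ⁻¹ / #H) := by
          rw [sum_const, nsmul_eq_mul]
          gcongr
          exact filter_subset _ _
      _ = δ⁻¹ * (#H / #H) := mul_div_left_comm _ _ _
      _ ≤ δ⁻¹ := mul_le_of_le_one_right (by positivity) (div_self_le_one _)
  have hnear : ∑ i ∈ H with ⌊‖x i‖ / δ⌋₊ ≤ #H, geomBound M (x i)
      ≤ 2 * ∑ k ∈ Icc 1 #H, ψ k := by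
    refine (sum_le_sum fun i hi => hle i (mem_filter.1 hi).1).trans
      (sum_floor_norm_div_le hδ (hx.mono (coe_subset.2 (filter_subset _ _))) (fun i hi => ?_)
        fun k => by positivity)
    obtain ⟨hiH, hfloor⟩ := mem_filter.1 hi
    exact mem_Icc.2 ⟨Nat.le_floor (by simpa using (one_le_div hδ).2 (hx₀ i hiH)), hfloor⟩
  rw [← sum_filter_add_sum_filter_not H fun i => ⌊‖x i‖ / δ⌋₊ ≤ #H]
  linarith [sum_inv_div_add_le hδ hM #H]

end WellSpaced

section Multiples

variable {a : ℤ} {q : ℕ} {α : ℝ}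

lemma inv_two_mul_le_norm_int_mul (hq : 0 < q) (haq : IsCoprime a (q : ℤ))
    (hα : |α - a / q| ≤ 1 / (q : ℝ) ^ 2) {k : ℤ} (hk₀ : k ≠ 0) (hk : 2 * |k| ≤ q) :
    (2 * (q : ℝ))⁻¹ ≤ ‖((k * α : ℝ) : UnitAddCircle)‖ := by
  have hq' : (0 : ℝ) < q := by exact_mod_cast hq
  set n := round (k * α)
  have hne : k * a - n * q ≠ 0 := fun h => by
    have hdvd : (q : ℤ) ∣ k := haq.symm.dvd_of_dvd_mul_right ⟨n, by linarith⟩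
    have hle := Int.le_of_dvd (abs_pos.2 hk₀) ((dvd_abs _ _).2 hdvd)
    have hpos : 0 < |k| := abs_pos.2 hk₀
    omega
  have hrat : 1 / (q : ℝ) ≤ |k * (a / q : ℝ) - n| := by
    have hone : (1 : ℝ) ≤ |k * (a : ℝ) - n * q| := by exact_mod_cast Int.one_le_abs hne
    have heq : k * (a / q : ℝ) - n = (k * a - n * q) / (q : ℝ) := by field_simp
    rw [heq, abs_div, abs_of_pos hq']
    gcongr
  have herr : |k * (α - a / q)| ≤ (2 * (q : ℝ))⁻¹ := by
    have hk' : 2 * |(k : ℝ)| ≤ q := by exact_mod_cast hk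
    calc |k * (α - a / q)| ≤ (q / 2) * (1 / (q : ℝ) ^ 2) := by
          rw [abs_mul]
          gcongr
          linarith
      _ = (2 * (q : ℝ))⁻¹ := by field_simp
  have htri : |k * (a / q : ℝ) - n| ≤ |k * α - n| + |k * (α - a / q)| := by
    rw [show k * (a / q : ℝ) - n = (k * α - n) - k * (α - a / q) by ring]
    exact abs_sub _ _
  have hhalf : 1 / (q : ℝ) = (2 * (q : ℝ))⁻¹ + (2 * (q : ℝ))⁻¹ := by field_simp; norm_num
  rw [UnitAddCircle.norm_eq]
  linarith

lemma pairwise_inv_two_mul_le_dist (hq : 0 < q) (haq : IsCoprime a (q : ℤ))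
    (hα : |α - a / q| ≤ 1 / (q : ℝ) ^ 2) {H : Set ℕ}
    (hH : ∀ h ∈ H, ∀ h' ∈ H, 2 * |(h : ℤ) - h'| ≤ q) :
    H.Pairwise fun h h' =>
      (2 * (q : ℝ))⁻¹ ≤ dist ((h * α : ℝ) : UnitAddCircle) ((h' * α : ℝ) : UnitAddCircle) := by
  intro h hh h' hh' hne
  have hle := inv_two_mul_le_norm_int_mul hq haq hα (sub_ne_zero.2 (Nat.cast_injective.ne hne))
    (hH h hh h' hh')
  rwa [Int.cast_sub, sub_mul, AddCircle.coe_sub, ← dist_eq_norm] at hle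

lemma sum_geomBound_block_le (hq : 0 < q) (haq : IsCoprime a (q : ℤ))
    (hα : |α - a / q| ≤ 1 / (q : ℝ) ^ 2) {M : ℝ} (hM : 0 < M) (b : ℕ) :
    ∑ h ∈ Ico b (b + (q / 2 + 1)), geomBound M ((h * α : ℝ) : UnitAddCircle)
      ≤ 4 * M + 4 * q * Real.log (1 + M) := by
  have hspaced := pairwise_inv_two_mul_le_dist hq haq hα
    (H := (Ico b (b + (q / 2 + 1)) : Finset ℕ)) fun h hh h' hh' => by
      simp only [coe_Ico, Set.mem_Ico] at hh hh'
      rcases abs_cases ((h : ℤ) - h') with ⟨habs, -⟩ | ⟨habs, -⟩ <;> rw [habs] <;> omega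
  have hsum := sum_geomBound_le_of_pairwise_le_dist (by positivity) hspaced hM
  rw [inv_inv] at hsum
  linarith

lemma sum_geomBound_le_of_two_mul_le (hq : 0 < q) (haq : IsCoprime a (q : ℤ))
    (hα : |α - a / q| ≤ 1 / (q : ℝ) ^ 2) {M : ℝ} (hM : 0 < M) {P : ℕ} (hPq : 2 * P ≤ q) :
    ∑ h ∈ Ico 1 P, geomBound M ((h * α : ℝ) : UnitAddCircle)
      ≤ 2 * q + 4 * q * Real.log (1 + P * M / q) := by
  have hspaced := pairwise_inv_two_mul_le_dist hq haq hα (H := (Ico 1 P : Finset ℕ))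
    fun h hh h' hh' => by
      simp only [coe_Ico, Set.mem_Ico] at hh hh'
      rcases abs_cases ((h : ℤ) - h') with ⟨habs, -⟩ | ⟨habs, -⟩ <;> rw [habs] <;> omega
  have hfar : ∀ h ∈ Ico 1 P, (2 * (q : ℝ))⁻¹ ≤ ‖((h * α : ℝ) : UnitAddCircle)‖ := fun h hh => by
    have hh' := mem_Ico.1 hh
    exact_mod_cast inv_two_mul_le_norm_int_mul hq haq hα (k := h) (by omega)
      (by rw [Nat.abs_cast]; omega)
  have hsum := sum_geomBound_le_of_le_norm (by positivity) hspaced hfar hM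
  have hlog : Real.log (1 + 2 * #(Ico 1 P) * M * (2 * (q : ℝ))⁻¹)
      ≤ Real.log (1 + P * M / q) := by
    have hcard : (#(Ico 1 P) : ℝ) ≤ P := by exact_mod_cast (by simp : #(Ico 1 P) ≤ P)
    calc Real.log (1 + 2 * #(Ico 1 P) * M * (2 * (q : ℝ))⁻¹)
        ≤ Real.log (1 + 2 * P * M * (2 * (q : ℝ))⁻¹) := by gcongr
      _ = Real.log (1 + P * M / q) := by
          congr 2
          field_simp
  rw [inv_inv] at hsum
  calc _ ≤ _ := hsum
    _ ≤ 2 * q + 2 * (2 * q) * Real.log (1 + P * M / q) := by gcongr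
    _ = _ := by ring

lemma sum_range_geomBound_le (hq : 0 < q) (haq : IsCoprime a (q : ℤ))
    (hα : |α - a / q| ≤ 1 / (q : ℝ) ^ 2) {M : ℝ} (hM : 0 < M) (n : ℕ) :
    ∑ h ∈ range (n * (q / 2 + 1)), geomBound M ((h * α : ℝ) : UnitAddCircle)
      ≤ n * (4 * M + 4 * q * Real.log (1 + M)) := by
  induction n with
  | zero => simp
  | succ n ih =>
    rw [add_mul, one_mul, ← sum_range_add_sum_Ico _ (Nat.le_add_right _ _)]
    push_cast
    linarith [sum_geomBound_block_le hq haq hα hM (n * (q / 2 + 1))]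

lemma sum_geomBound_le_of_le_two_mul (hq : 0 < q) (haq : IsCoprime a (q : ℤ))
    (hα : |α - a / q| ≤ 1 / (q : ℝ) ^ 2) {M : ℝ} (hM : 0 < M) {P : ℕ} (hPq : q ≤ 2 * P) :
    ∑ h ∈ Ico 1 P, geomBound M ((h * α : ℝ) : UnitAddCircle)
      ≤ 16 * (P * M / q) + 16 * P * Real.log (1 + M) := by
  set C := 4 * M + 4 * q * Real.log (1 + M) with hC
  set l := q / 2 + 1
  have hq' : (0 : ℝ) < q := by exact_mod_cast hq
  have hlog : 0 ≤ Real.log (1 + M) := Real.log_nonneg (by linarith)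
  have hsub : Ico 1 P ⊆ range ((P / l + 1) * l) := fun h hh => by
    have hlt := Nat.lt_div_mul_add (a := P) (b := l) (by omega)
    have hhP := (mem_Ico.1 hh).2
    rw [mem_range, add_mul, one_mul]
    omega
  have hcount : ((P / l + 1 : ℕ) : ℝ) ≤ 4 * P / q := by
    have hlq : (q : ℝ) ≤ 2 * l := by exact_mod_cast (by omega : q ≤ 2 * l)
    have hPq' : (q : ℝ) ≤ 2 * P := by exact_mod_cast hPq
    have hdiv : ((P / l : ℕ) : ℝ) ≤ 2 * P / q := by
      refine Nat.cast_div_le.trans ?_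
      rw [div_le_div_iff₀ (by linarith) hq']
      nlinarith
    have hone : (1 : ℝ) ≤ 2 * P / q := by rwa [one_le_div hq']
    push_cast
    linarith [show (4 : ℝ) * P / q = 2 * P / q + 2 * P / q by ring]
  calc ∑ h ∈ Ico 1 P, geomBound M ((h * α : ℝ) : UnitAddCircle)
      ≤ ∑ h ∈ range ((P / l + 1) * l), geomBound M ((h * α : ℝ) : UnitAddCircle) :=
        sum_le_sum_of_subset_of_nonneg hsub fun h _ _ => geomBound_nonneg hM _
    _ ≤ (P / l + 1 : ℕ) * C := sum_range_geomBound_le hq haq hα hM _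
    _ ≤ 4 * P / q * C := by gcongr
    _ = 16 * (P * M / q) + 16 * P * Real.log (1 + M) := by
        rw [hC]
        field_simp
        ring

end Multiples

section WeightedMultiples

lemma log_one_add_le_one_add_log {x : ℝ} (hx : 1 ≤ x) : Real.log (1 + x) ≤ 1 + Real.log x := by
  have hle : 1 + x ≤ Real.exp 1 * x := by nlinarith [Real.add_one_le_exp 1]
  have hlog := Real.log_le_log (by linarith) hle
  rwa [Real.log_mul (Real.exp_pos 1).ne' (by linarith), Real.log_exp] at hlog

lemma log_one_add_le_div_mul {x y : ℝ} (hy : 0 < y) (hxy : y ≤ x) :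
    Real.log (1 + x) ≤ x / y * Real.log (1 + y) := by
  have hbern := one_add_mul_self_le_rpow_one_add (s := y) (by linarith) ((one_le_div hy).2 hxy)
  rw [div_mul_cancel₀ x hy.ne'] at hbern
  have hlog := Real.log_le_log (by linarith) hbern
  rwa [Real.log_rpow (by linarith)] at hlog

lemma sum_Icc_floor_one_div_le {x : ℝ} (hx : 1 ≤ x) :
    ∑ d ∈ Icc 1 ⌊x⌋₊, (1 : ℝ) / d ≤ 1 + Real.log x := by
  have h := harmonic_floor_le_one_add_log x hx
  rw [harmonic_eq_sum_Icc] at h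
  push_cast at h
  simpa only [one_div] using h

lemma sum_sum_divisors_gt_le {P D : ℕ} (hD : 1 ≤ D) :
    ∑ h ∈ Ico 1 P, ∑ d ∈ h.divisors with D < d, (1 : ℝ) / d ≤ P / D := by
  have hcomm : ∑ h ∈ Ico 1 P, ∑ d ∈ h.divisors with D < d, (1 : ℝ) / d
      = ∑ d ∈ Ioc D P, ∑ h ∈ Ico 1 P with d ∣ h, (1 : ℝ) / d := by
    refine sum_comm' fun h d => ?_
    simp only [mem_Ico, mem_filter, Nat.mem_divisors, mem_Ioc]
    refine ⟨fun ⟨hh, ⟨hd, _⟩, hDd⟩ => ⟨⟨hh, hd⟩, hDd, ?_⟩, fun ⟨⟨hh, hd⟩, hDd, _⟩ =>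
      ⟨hh, ⟨hd, by omega⟩, hDd⟩⟩
    exact (Nat.le_of_dvd hh.1 hd).trans hh.2.le
  have hmult : ∀ d ∈ Ioc D P,
      ∑ h ∈ Ico 1 P with d ∣ h, (1 : ℝ) / d ≤ P * ((d : ℝ) ^ 2)⁻¹ := fun d _ => by
    have hcard : (#{h ∈ Ico 1 P | d ∣ h} : ℝ) ≤ P / d := by
      have hsub : #{h ∈ Ico 1 P | d ∣ h} ≤ #{h ∈ Ioc 0 P | d ∣ h} :=
        card_le_card (filter_subset_filter _ fun h hh => by
          simp only [mem_Ico, mem_Ioc] at *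
          omega)
      rw [Nat.Ioc_filter_dvd_card_eq_div] at hsub
      exact le_trans (by exact_mod_cast hsub) Nat.cast_div_le
    rw [sum_const, nsmul_eq_mul]
    calc (#{h ∈ Ico 1 P | d ∣ h} : ℝ) * (1 / d) ≤ P / d * (1 / d) := by gcongr
      _ = P * ((d : ℝ) ^ 2)⁻¹ := by ring
  rw [hcomm]
  rcases le_or_gt P D with hPD | hPD
  · rw [Ioc_eq_empty (by omega), sum_empty]
    positivity
  · refine (sum_le_sum hmult).trans ?_
    rw [← mul_sum, div_eq_mul_inv]
    gcongr
    refine (sum_Ioc_inv_sq_le_sub (by omega) hPD.le).trans (sub_le_self _ (by positivity))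

lemma sum_invDivisorSum_mul_le {G : ℕ → ℝ} {C : ℝ} (hG₀ : ∀ h, 0 ≤ G h) (hG : ∀ h, G h ≤ C)
    (P : ℕ) {x : ℝ} (hx : 1 ≤ x) :
    ∑ h ∈ Ico 1 P, invDivisorSum h * G h
      ≤ (1 + Real.log x) * ∑ h ∈ Ico 1 P, G h + 2 * C * P / x := by
  set D := ⌊x⌋₊
  have hD : 1 ≤ D := Nat.le_floor (by exact_mod_cast hx)
  have hC : 0 ≤ C := (hG₀ 0).trans (hG 0)
  have hsmall (h : ℕ) : ∑ d ∈ h.divisors with d ≤ D, (1 : ℝ) / d ≤ 1 + Real.log x := by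
    refine (sum_le_sum_of_subset_of_nonneg (fun d hd => ?_) fun _ _ _ => by positivity).trans
      (sum_Icc_floor_one_div_le hx)
    obtain ⟨hdvd, hle⟩ := mem_filter.1 hd
    exact mem_Icc.2 ⟨Nat.pos_of_mem_divisors hdvd, hle⟩
  calc ∑ h ∈ Ico 1 P, invDivisorSum h * G h
      ≤ ∑ h ∈ Ico 1 P, ((1 + Real.log x) * G h
          + (∑ d ∈ h.divisors with D < d, (1 : ℝ) / d) * C) := by
        gcongr with h
        rw [invDivisorSum, ← sum_filter_add_sum_filter_not h.divisors (· ≤ D), add_mul]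
        simp only [not_le]
        gcongr
        exacts [hG₀ h, hsmall h, hG h]
    _ = (1 + Real.log x) * ∑ h ∈ Ico 1 P, G h
          + (∑ h ∈ Ico 1 P, ∑ d ∈ h.divisors with D < d, (1 : ℝ) / d) * C := by
        rw [sum_add_distrib, ← mul_sum, ← sum_mul]
    _ ≤ (1 + Real.log x) * ∑ h ∈ Ico 1 P, G h + P / (x / 2) * C := by
        gcongr
        refine (sum_sum_divisors_gt_le hD).trans ?_
        gcongr
        exact (Nat.div_two_lt_floor hx).le
    _ = (1 + Real.log x) * ∑ h ∈ Ico 1 P, G h + 2 * C * P / x := by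
        field_simp

variable {a : ℤ} {q P : ℕ} {α M R : ℝ}

lemma sum_invDivisorSum_mul_geomBound_le_of_two_mul_le (haq : IsCoprime a (q : ℤ))
    (hα : |α - a / q| ≤ 1 / (q : ℝ) ^ 2) (hR : 1 ≤ R) (hRq : R ≤ q) (hM : 0 < M)
    (hqR : q * R ≤ P * M) (hPq : 2 * P ≤ q) :
    ∑ h ∈ Ico 1 P, invDivisorSum h * geomBound M ((h * α : ℝ) : UnitAddCircle)
      ≤ 10 * (P * M / R) * (1 + Real.log R) ^ 2 := by
  have hq' : (0 : ℝ) < q := by linarith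
  have hR₀ : 0 < R := by linarith
  have hlogR : 0 ≤ Real.log R := Real.log_nonneg hR
  have hqN : (q : ℝ) ≤ P * M / R := by rwa [le_div_iff₀ hR₀]
  have hsum : ∑ h ∈ Ico 1 P, geomBound M ((h * α : ℝ) : UnitAddCircle)
      ≤ P * M / R * (2 + 4 * (1 + Real.log R)) := by
    calc _ ≤ 2 * q + 4 * q * Real.log (1 + P * M / q) :=
          sum_geomBound_le_of_two_mul_le (by exact_mod_cast hq') haq hα hM hPq
      _ ≤ 2 * q + 4 * q * (P * M / q / R * (1 + Real.log R)) := by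
          gcongr
          refine (log_one_add_le_div_mul hR₀ ((le_div_iff₀' hq').2 hqR)).trans ?_
          gcongr
          exact log_one_add_le_one_add_log hR
      _ = 2 * q + 4 * (P * M / R) * (1 + Real.log R) := by field_simp
      _ ≤ 2 * (P * M / R) + 4 * (P * M / R) * (1 + Real.log R) := by gcongr
      _ = P * M / R * (2 + 4 * (1 + Real.log R)) := by ring
  calc _ ≤ (1 + Real.log R) * ∑ h ∈ Ico 1 P, geomBound M ((h * α : ℝ) : UnitAddCircle)
          + 2 * (2 * M) * P / R :=
        sum_invDivisorSum_mul_le (fun h => geomBound_nonneg hM _) (fun h => geomBound_le hM _) P hR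
    _ ≤ (1 + Real.log R) * (P * M / R * (2 + 4 * (1 + Real.log R))) + 2 * (2 * M) * P / R := by
        gcongr
    _ = P * M / R * (4 * (1 + Real.log R) ^ 2 + 2 * (1 + Real.log R) + 4) := by ring
    _ ≤ P * M / R * (10 * (1 + Real.log R) ^ 2) := by
        gcongr
        nlinarith
    _ = 10 * (P * M / R) * (1 + Real.log R) ^ 2 := by ring

lemma sum_invDivisorSum_mul_geomBound_le_of_le_two_mul (haq : IsCoprime a (q : ℤ))
    (hα : |α - a / q| ≤ 1 / (q : ℝ) ^ 2) (hR : 1 ≤ R) (hRq : R ≤ q) (hM : 1 ≤ M)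
    (hPq : q ≤ 2 * P) :
    ∑ h ∈ Ico 1 P, invDivisorSum h * geomBound M ((h * α : ℝ) : UnitAddCircle)
      ≤ 20 * (P * M / R) * (1 + Real.log R) ^ 2 + 20 * P * (1 + Real.log M) ^ 2 := by
  set x := min M R
  have hx : 1 ≤ x := le_min hM hR
  have hM₀ : 0 < M := by linarith
  have hlogR : 0 ≤ Real.log R := Real.log_nonneg hR
  have hlogM : 0 ≤ Real.log M := Real.log_nonneg hM
  have hlogx : 0 ≤ Real.log x := Real.log_nonneg hx
  have hlog1M : 0 ≤ Real.log (1 + M) := Real.log_nonneg (by linarith)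
  have hinv : 1 / x ≤ 1 / R + 1 / M := by
    rcases min_choice M R with h | h <;> simp only [x, h]
    exacts [le_add_of_nonneg_left (by positivity), le_add_of_nonneg_right (by positivity)]
  have hsum : ∑ h ∈ Ico 1 P, geomBound M ((h * α : ℝ) : UnitAddCircle)
      ≤ 16 * (P * M / R) + 16 * P * Real.log (1 + M) :=
    (sum_geomBound_le_of_le_two_mul (by exact_mod_cast (by linarith : (0 : ℝ) < q)) haq hα hM₀
      hPq).trans (by gcongr)
  calc _ ≤ (1 + Real.log x) * ∑ h ∈ Ico 1 P, geomBound M ((h * α : ℝ) : UnitAddCircle)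
          + 2 * (2 * M) * P / x :=
        sum_invDivisorSum_mul_le (fun h => geomBound_nonneg hM₀ _) (fun h => geomBound_le hM₀ _) P
          hx
    _ ≤ (1 + Real.log x) * (16 * (P * M / R) + 16 * P * Real.log (1 + M))
          + 2 * (2 * M) * P / x := by gcongr
    _ = (1 + Real.log x) * (16 * (P * M / R)) + (1 + Real.log x) * (16 * P * Real.log (1 + M))
          + 4 * (P * M) * (1 / x) := by ring
    _ ≤ (1 + Real.log R) * (16 * (P * M / R)) + (1 + Real.log M) * (16 * P * (1 + Real.log M))
          + 4 * (P * M) * (1 / R + 1 / M) := by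
        gcongr
        exacts [min_le_right _ _, min_le_left _ _, log_one_add_le_one_add_log hM]
    _ = P * M / R * (16 * (1 + Real.log R) + 4) + P * (16 * (1 + Real.log M) ^ 2 + 4) := by
        field_simp
        ring
    _ ≤ P * M / R * (20 * (1 + Real.log R) ^ 2) + P * (20 * (1 + Real.log M) ^ 2) := by
        gcongr <;> nlinarith
    _ = _ := by ring

lemma sum_invDivisorSum_mul_geomBound_le (haq : IsCoprime a (q : ℤ))
    (hα : |α - a / q| ≤ 1 / (q : ℝ) ^ 2) (hR : 1 ≤ R) (hRq : R ≤ q) (hM : 1 ≤ M)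
    (hqR : q * R ≤ P * M) :
    ∑ h ∈ Ico 1 P, invDivisorSum h * geomBound M ((h * α : ℝ) : UnitAddCircle)
      ≤ 20 * (P * M / R) * (1 + Real.log R) ^ 2 + 20 * P * (1 + Real.log M) ^ 2 := by
  rcases le_total (2 * P) q with hPq | hPq
  · refine (sum_invDivisorSum_mul_geomBound_le_of_two_mul_le haq hα hR hRq (by linarith) hqR
      hPq).trans ?_
    have hmain : 0 ≤ P * M / R * (1 + Real.log R) ^ 2 := by positivity
    have hrest : 0 ≤ P * (1 + Real.log M) ^ 2 := by positivity
    linarith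
  · exact sum_invDivisorSum_mul_geomBound_le_of_le_two_mul haq hα hR hRq hM hPq

end WeightedMultiples

section Bilinear

lemma sum_norm_sum_e_sq_le {ι : Type*} {s : Finset ι} {c : ι → ℂ} {x : ι → ℝ} {K : ι → ℕ}
    {M C : ℝ} (hM : 0 < M) (hK : ∀ i ∈ s, (K i : ℝ) ≤ M) (hC : ∀ i ∈ s, ‖c i‖ ≤ C) :
    ∑ m ∈ Icc 1 ⌊M⌋₊, ‖∑ i ∈ s with m ≤ K i, c i * e (m * x i)‖ ^ 2
      ≤ C ^ 2 * ∑ i ∈ s, ∑ j ∈ s, geomBound M ((x i - x j : ℝ) : UnitAddCircle) := by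
  have hexpand : ((∑ m ∈ Icc 1 ⌊M⌋₊, ‖∑ i ∈ s with m ≤ K i, c i * e (m * x i)‖ ^ 2 : ℝ) : ℂ)
      = ∑ i ∈ s, ∑ j ∈ s, c i * starRingEnd ℂ (c j) *
          ∑ m ∈ Icc 1 (min (K i) (K j)), e (m * (x i - x j)) := by
    push_cast
    simp only [← Complex.mul_conj', map_sum, sum_mul_sum, map_mul, conj_e]
    simp only [mul_sum]
    rw [sum_comm' (t' := s) (s' := fun i => Icc 1 (K i)) fun m i => ?_]
    · refine sum_congr rfl fun i _ => ?_
      rw [sum_comm' (t' := s) (s' := fun j => Icc 1 (min (K i) (K j))) fun m j => ?_]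
      · refine sum_congr rfl fun j _ => sum_congr rfl fun m _ => ?_
        rw [mul_sub, sub_eq_add_neg, e_add]
        ring
      · simp only [mem_Icc, mem_filter, le_min_iff]
        tauto
    · simp only [mem_Icc, mem_filter]
      refine ⟨fun ⟨hm, hi, hle⟩ => ⟨⟨hm.1, hle⟩, hi⟩, fun ⟨hm, hi⟩ => ⟨⟨hm.1, ?_⟩, hi, hm.2⟩⟩
      exact hm.2.trans (Nat.le_floor (hK i hi))
  have hnonneg : 0 ≤ ∑ m ∈ Icc 1 ⌊M⌋₊, ‖∑ i ∈ s with m ≤ K i, c i * e (m * x i)‖ ^ 2 :=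
    sum_nonneg fun _ _ => by positivity
  rw [← Real.norm_of_nonneg hnonneg, ← Complex.norm_real, hexpand, mul_sum]
  refine (norm_sum_le _ _).trans (sum_le_sum fun i hi => ?_)
  rw [mul_sum]
  refine (norm_sum_le _ _).trans (sum_le_sum fun j hj => ?_)
  rw [norm_mul, norm_mul, RCLike.norm_conj, sq]
  gcongr
  · exact mul_nonneg ((norm_nonneg _).trans (hC i hi)) ((norm_nonneg _).trans (hC j hj))
  · exact (norm_nonneg _).trans (hC i hi)
  · exact hC i hi
  · exact hC j hj
  · exact_mod_cast norm_sum_Icc_e_le hM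
      (le_trans (by exact_mod_cast min_le_left _ _) (hK i hi)) (x i - x j)

lemma norm_sum_sum_e_sq_le {ι : Type*} {s : Finset ι} {c : ι → ℂ} {g : ℕ → ℂ} {x : ι → ℝ}
    {K : ι → ℕ} {M A C : ℝ} (hM : 0 < M) (hK : ∀ i ∈ s, (K i : ℝ) ≤ M) (hC : ∀ i ∈ s, ‖c i‖ ≤ C)
    (hA : ∀ m, ‖g m‖ ≤ A) :
    ‖∑ i ∈ s, ∑ m ∈ Icc 1 (K i), c i * g m * e (m * x i)‖ ^ 2
      ≤ M * A ^ 2 * (C ^ 2 *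
          ∑ i ∈ s, ∑ j ∈ s, geomBound M ((x i - x j : ℝ) : UnitAddCircle)) := by
  have hcomm : ∑ i ∈ s, ∑ m ∈ Icc 1 (K i), c i * g m * e (m * x i)
      = ∑ m ∈ Icc 1 ⌊M⌋₊, g m * ∑ i ∈ s with m ≤ K i, c i * e (m * x i) := by
    simp only [mul_sum]
    rw [sum_comm' (t' := Icc 1 ⌊M⌋₊) (s' := fun m => {i ∈ s | m ≤ K i}) fun i m => ?_]
    · exact sum_congr rfl fun m _ => sum_congr rfl fun i _ => by ring
    · simp only [mem_Icc, mem_filter]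
      refine ⟨fun ⟨hi, hm⟩ => ⟨⟨hi, hm.2⟩, hm.1, ?_⟩, fun ⟨⟨hi, hle⟩, hm⟩ => ⟨hi, hm.1, hle⟩⟩
      exact hm.2.trans (Nat.le_floor (hK i hi))
  have hg : ∑ m ∈ Icc 1 ⌊M⌋₊, ‖g m‖ ^ 2 ≤ M * A ^ 2 := by
    calc ∑ m ∈ Icc 1 ⌊M⌋₊, ‖g m‖ ^ 2 ≤ ∑ m ∈ Icc 1 ⌊M⌋₊, A ^ 2 := by
          gcongr with m
          exact hA m
      _ = ⌊M⌋₊ * A ^ 2 := by simp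
      _ ≤ M * A ^ 2 := by
          gcongr
          exact Nat.floor_le hM.le
  rw [hcomm]
  calc _ ≤ (∑ m ∈ Icc 1 ⌊M⌋₊, ‖g m‖ * ‖∑ i ∈ s with m ≤ K i, c i * e (m * x i)‖) ^ 2 := by
        gcongr
        exact (norm_sum_le _ _).trans (sum_le_sum fun m _ => (norm_mul _ _).le)
    _ ≤ _ := sum_mul_sq_le_sq_mul_sq _ _ _
    _ ≤ _ := mul_le_mul hg (sum_norm_sum_e_sq_le hM hK hC) (by positivity) (by positivity)

lemma sum_filter_lt_sub {s : Finset ℕ} {P : ℕ} (hs : ∀ m ∈ s, ∀ n ∈ s, m < n + P)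
    (F : ℕ → ℝ) :
    ∑ n ∈ s, ∑ m ∈ s with n < m, F (m - n) = ∑ h ∈ Ico 1 P, #{n ∈ s | n + h ∈ s} * F h := by
  have hinner : ∀ n ∈ s, ∑ m ∈ s with n < m, F (m - n)
      = ∑ h ∈ Ico 1 P with n + h ∈ s, F h := fun n hn => by
    refine sum_nbij' (· - n) (n + ·) (fun m hm => ?_) (fun h hh => ?_) (fun m hm => ?_)
      (fun h _ => ?_) fun _ _ => rfl
    · obtain ⟨hm, hlt⟩ := mem_filter.1 hm
      have := hs m hm n hn
      rw [mem_filter, mem_Ico, Nat.add_sub_cancel' hlt.le]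
      exact ⟨by omega, hm⟩
    · obtain ⟨hh, hmem⟩ := mem_filter.1 hh
      have := mem_Ico.1 hh
      exact mem_filter.2 ⟨hmem, by omega⟩
    · exact Nat.add_sub_cancel' (mem_filter.1 hm).2.le
    · exact Nat.add_sub_cancel_left n h
  rw [sum_congr rfl hinner, sum_comm' (t' := Ico 1 P) (s' := fun h => {n ∈ s | n + h ∈ s})
    fun n h => by simp only [mem_filter]; tauto]
  simp only [sum_const, nsmul_eq_mul]

lemma sum_sum_sub_eq {s : Finset ℕ} {P : ℕ} (hs : ∀ m ∈ s, ∀ n ∈ s, m < n + P) {F : ℤ → ℝ}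
    (hF : ∀ k, F (-k) = F k) :
    ∑ m ∈ s, ∑ n ∈ s, F (m - n)
      = #s * F 0 + 2 * ∑ h ∈ Ico 1 P, #{n ∈ s | n + h ∈ s} * F h := by
  have hlt : ∑ n ∈ s, ∑ m ∈ s with n < m, F (m - n)
      = ∑ h ∈ Ico 1 P, #{n ∈ s | n + h ∈ s} * F h := by
    rw [← sum_filter_lt_sub hs fun h => F h]
    refine sum_congr rfl fun n _ => sum_congr rfl fun m hm => ?_
    rw [Nat.cast_sub (mem_filter.1 hm).2.le]
  have hgt : ∑ m ∈ s, ∑ n ∈ s with m < n, F (m - n)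
      = ∑ h ∈ Ico 1 P, #{n ∈ s | n + h ∈ s} * F h := by
    rw [← hlt]
    exact sum_congr rfl fun m _ => sum_congr rfl fun n _ => by rw [← hF, neg_sub]
  have hsplit : ∀ m ∈ s, ∑ n ∈ s, F (m - n)
      = F 0 + ∑ n ∈ s with n < m, F (m - n) + ∑ n ∈ s with m < n, F (m - n) := fun m hm => by
    have hzero : F 0 = ∑ n ∈ s, if n = m then F (m - n) else 0 := by
      rw [sum_ite_eq' s m, if_pos hm, sub_self]
    rw [hzero, sum_filter, sum_filter, ← sum_add_distrib, ← sum_add_distrib]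
    refine sum_congr rfl fun n _ => ?_
    rcases lt_trichotomy n m with h | h | h
    · simp [h, h.ne, h.not_gt]
    · simp [h]
    · simp [h, h.ne', h.not_gt]
  rw [sum_congr rfl hsplit, sum_add_distrib, sum_add_distrib, hgt, sum_const, nsmul_eq_mul,
    sum_comm' (t' := s) (s' := fun n => {m ∈ s | n < m}) fun m n => by
      simp only [mem_filter]; tauto, hlt]
  ring

lemma card_prime_pairs_mul_log_two_mul_sq_le {h P : ℕ} (hh : h ≠ 0) (hP : 2 ≤ P) :
    #{n ∈ Ioc P (2 * P) | n.Prime ∧ (n + h).Prime} * Real.log (2 * P) ^ 2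
      ≤ 2304 * P * invDivisorSum h := by
  have hP' : (2 : ℝ) ≤ P := by exact_mod_cast hP
  have hlog : Real.log (2 * P) ≤ 2 * Real.log P := by
    rw [Real.log_mul (by norm_num) (by positivity)]
    linarith [Real.log_le_log (by norm_num) hP']
  have hlog' : 0 ≤ Real.log (2 * P) := Real.log_nonneg (by linarith)
  calc _ ≤ #{n ∈ Ioc P (2 * P) | n.Prime ∧ (n + h).Prime} * (2 * Real.log P) ^ 2 := by gcongr
    _ = 4 * (#{n ∈ Ioc P (2 * P) | n.Prime ∧ (n + h).Prime} * Real.log P ^ 2) := by ring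
    _ ≤ 4 * (576 * P * invDivisorSum h) :=
        mul_le_mul_of_nonneg_left (card_prime_pairs_mul_log_sq_le hh (one_le_two.trans hP))
          zero_le_four
    _ = 2304 * P * invDivisorSum h := by ring

lemma sum_sum_prime_geomBound_mul_log_sq_le {P : ℕ} {M : ℝ} (hM : 0 < M) (α : ℝ) :
    (∑ p ∈ Ioc P (2 * P) with p.Prime, ∑ p' ∈ Ioc P (2 * P) with p'.Prime,
        geomBound M ((p * α - p' * α : ℝ) : UnitAddCircle)) * Real.log (2 * P) ^ 2
      ≤ 2 * M * P * Real.log (2 * P) ^ 2 + 4608 * P *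
          ∑ h ∈ Ico 1 P, invDivisorSum h * geomBound M ((h * α : ℝ) : UnitAddCircle) := by
  set s := {p ∈ Ioc P (2 * P) | p.Prime} with hs
  have hsum := sum_sum_sub_eq (s := s) (P := P)
    (F := fun k => geomBound M ((k * α : ℝ) : UnitAddCircle))
    (fun m hm n hn => by
      have := mem_Ioc.1 (mem_filter.1 hm).1
      have := mem_Ioc.1 (mem_filter.1 hn).1
      omega)
    fun k => by rw [Int.cast_neg, neg_mul, AddCircle.coe_neg, geomBound_neg]
  simp only [Int.cast_sub, Int.cast_natCast, sub_mul] at hsum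
  have hcard : #s ≤ P := by
    have := card_filter_le (Ioc P (2 * P)) Nat.Prime
    rw [Nat.card_Ioc, ← hs] at this
    omega
  have hdiag : #s * geomBound M (((0 : ℤ) * α : ℝ) : UnitAddCircle) ≤ 2 * M * P := by
    rw [mul_comm (2 * M)]
    exact mul_le_mul (by exact_mod_cast hcard) (geomBound_le hM _) (geomBound_nonneg hM _)
      P.cast_nonneg
  have hoff : ∀ h ∈ Ico 1 P, #{n ∈ s | n + h ∈ s} * Real.log (2 * P) ^ 2
      ≤ 2304 * P * invDivisorSum h := fun h hh => by
    have hh' := mem_Ico.1 hh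
    refine le_trans ?_ (card_prime_pairs_mul_log_two_mul_sq_le (by omega) (by omega))
    gcongr
    refine fun n hn => ?_
    simp only [hs, mem_filter] at hn ⊢
    exact ⟨hn.1.1, hn.1.2, hn.2.2⟩
  rw [hsum, add_mul, mul_assoc 2, sum_mul, mul_sum, mul_sum]
  refine add_le_add (by gcongr) (sum_le_sum fun h hh => ?_)
  have := mul_le_mul_of_nonneg_right (hoff h hh)
    (geomBound_nonneg hM ((h * α : ℝ) : UnitAddCircle))
  linarith

/-- The function `(1 + log x) / √x`. Up to constants, the primes in `(P, 2P]` contribute to the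
bilinear sum the fraction `logDivSqrt P + logDivSqrt R + logDivSqrt (N / P)` of the trivial
bound. -/
noncomputable def logDivSqrt (x : ℝ) : ℝ := (1 + Real.log x) / √x

lemma logDivSqrt_nonneg {x : ℝ} (hx : 1 ≤ x) : 0 ≤ logDivSqrt x := by
  have := Real.log_nonneg hx
  unfold logDivSqrt
  positivity

lemma logDivSqrt_sq {x : ℝ} (hx : 0 ≤ x) : logDivSqrt x ^ 2 = (1 + Real.log x) ^ 2 / x := by
  rw [logDivSqrt, div_pow, Real.sq_sqrt hx]

lemma norm_sum_prime_block_sq_le {P N : ℕ} {B : ℝ} (hP : 1 ≤ P) (hPN : P ≤ N) {f : ℕ → ℂ}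
    (hf : ∀ n, ‖f n‖ ≤ B) (α : ℝ) :
    ‖∑ p ∈ Ioc P (2 * P) with p.Prime, ∑ m ∈ Icc 1 (N / p),
        f p * Real.log p * f m * e (m * (p * α))‖ ^ 2
      ≤ B ^ 4 * (N / P) * (2 * N * Real.log (2 * P) ^ 2 + 4608 * P *
          ∑ h ∈ Ico 1 P, invDivisorSum h * geomBound (N / P) ((h * α : ℝ) : UnitAddCircle)) := by
  have hP' : (0 : ℝ) < P := by exact_mod_cast hP
  have hN' : (0 : ℝ) < N := by exact_mod_cast hP.trans hPN
  have hM : 0 < (N / P : ℝ) := by positivity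
  have hK : ∀ p ∈ {p ∈ Ioc P (2 * P) | p.Prime}, ((N / p : ℕ) : ℝ) ≤ N / P := fun p hp => by
    have hPp : P < p := (mem_Ioc.1 (mem_filter.1 hp).1).1
    refine Nat.cast_div_le.trans ?_
    gcongr
  have hC : ∀ p ∈ {p ∈ Ioc P (2 * P) | p.Prime}, ‖f p * Real.log p‖ ≤ B * Real.log (2 * P) :=
    fun p hp => by
      obtain ⟨hPp, hp2⟩ := mem_Ioc.1 (mem_filter.1 hp).1
      have hp1 : (1 : ℝ) ≤ p := by exact_mod_cast hP.trans hPp.le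
      have hp2' : (p : ℝ) ≤ 2 * P := by exact_mod_cast hp2
      rw [norm_mul, Complex.norm_of_nonneg (Real.log_nonneg hp1)]
      exact mul_le_mul (hf p) (Real.log_le_log (by positivity) hp2') (Real.log_nonneg hp1)
        ((norm_nonneg _).trans (hf p))
  have hbilinear := norm_sum_sum_e_sq_le (x := fun p : ℕ => (p * α : ℝ)) hM hK hC hf
  have hprimes := sum_sum_prime_geomBound_mul_log_sq_le (P := P) hM α
  rw [mul_assoc 2 (N / P : ℝ), div_mul_cancel₀ _ hP'.ne'] at hprimes
  calc _ ≤ _ := hbilinear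
    _ = B ^ 4 * (N / P) * ((∑ p ∈ Ioc P (2 * P) with p.Prime, ∑ p' ∈ Ioc P (2 * P) with p'.Prime,
          geomBound (N / P) ((p * α - p' * α : ℝ) : UnitAddCircle)) * Real.log (2 * P) ^ 2) := by
        ring
    _ ≤ _ := by gcongr

lemma norm_sum_prime_block_le {P N q : ℕ} {a : ℤ} {α R B : ℝ} (haq : IsCoprime a (q : ℤ))
    (hα : |α - a / q| ≤ 1 / (q : ℝ) ^ 2) (hR : 1 ≤ R) (hRq : R ≤ q) (hqR : q * R ≤ N)
    (hP : 1 ≤ P) (hPN : P ≤ N) {f : ℕ → ℂ} (hf : ∀ n, ‖f n‖ ≤ B) :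
    ‖∑ p ∈ Ioc P (2 * P) with p.Prime, ∑ m ∈ Icc 1 (N / p),
        f p * Real.log p * f m * e (m * (p * α))‖
      ≤ B ^ 2 * N * (2 * logDivSqrt P + 304 * logDivSqrt R + 304 * logDivSqrt (N / P)) := by
  have hP' : (1 : ℝ) ≤ P := by exact_mod_cast hP
  have hP₀ : (P : ℝ) ≠ 0 := by positivity
  have hN₀ : (N : ℝ) ≠ 0 := by exact_mod_cast Nat.one_le_iff_ne_zero.1 (hP.trans hPN)
  have hM : (1 : ℝ) ≤ N / P := by
    rw [one_le_div (by positivity)]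
    exact_mod_cast hPN
  have hPM : (P : ℝ) * (N / P) = N := mul_div_cancel₀ _ hP₀
  have hsum := sum_invDivisorSum_mul_geomBound_le haq hα hR hRq hM (hqR.trans_eq hPM.symm)
  rw [hPM] at hsum
  have hlog : Real.log (2 * P) ^ 2 ≤ 2 * (1 + Real.log P) ^ 2 := by
    have hlogP := Real.log_nonneg hP'
    rw [Real.log_mul (by norm_num) hP₀]
    nlinarith [Real.log_two_lt_d9, Real.log_two_gt_d9]
  have hP_nonneg := logDivSqrt_nonneg hP'
  have hR_nonneg := logDivSqrt_nonneg hR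
  have hM_nonneg := logDivSqrt_nonneg hM
  refine le_of_sq_le_sq ((norm_sum_prime_block_sq_le hP hPN hf α).trans ?_) (by positivity)
  calc _ ≤ B ^ 4 * (N / P) * (2 * N * (2 * (1 + Real.log P) ^ 2) + 4608 * P *
          (20 * (N / R) * (1 + Real.log R) ^ 2 + 20 * P * (1 + Real.log (N / P)) ^ 2)) := by
        gcongr
    _ = (B ^ 2 * N) ^ 2 * (4 * logDivSqrt P ^ 2 + 92160 * logDivSqrt R ^ 2
          + 92160 * logDivSqrt (N / P) ^ 2) := by
        rw [logDivSqrt_sq (by positivity), logDivSqrt_sq (by positivity),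
          logDivSqrt_sq (by positivity)]
        field_simp
        ring
    _ ≤ (B ^ 2 * N) ^ 2 *
          (2 * logDivSqrt P + 304 * logDivSqrt R + 304 * logDivSqrt (N / P)) ^ 2 := by
        gcongr
        nlinarith [mul_nonneg hP_nonneg hR_nonneg, mul_nonneg hP_nonneg hM_nonneg,
          mul_nonneg hR_nonneg hM_nonneg]
    _ = _ := by ring

/-- A function whose dyadic differences majorize `logDivSqrt`. -/
noncomputable def logDivSqrtPrimitive (x : ℝ) : ℝ := (19 / 2 + 7 / 2 * Real.log x) / √x

lemma logDivSqrt_le_primitive_sub {x : ℝ} (hx : 1 ≤ x) :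
    logDivSqrt x ≤ logDivSqrtPrimitive x - logDivSqrtPrimitive (2 * x) := by
  have hlog := Real.log_nonneg hx
  have hinv : 1 / √2 ≤ 0.7073 := by
    rw [div_le_iff₀ (by positivity)]
    linarith [Real.lt_sqrt_of_sq_lt (by norm_num : (1.414 : ℝ) ^ 2 < 2)]
  have hmul : (19 / 2 + 7 / 2 * (Real.log 2 + Real.log x)) * (1 / √2)
      ≤ (19 / 2 + 7 / 2 * (Real.log 2 + Real.log x)) * 0.7073 := by
    have := Real.log_pos one_lt_two
    gcongr
  calc logDivSqrt x
      ≤ (19 / 2 + 7 / 2 * Real.log x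
          - (19 / 2 + 7 / 2 * (Real.log 2 + Real.log x)) * (1 / √2)) / √x := by
        unfold logDivSqrt
        gcongr
        linarith [Real.log_two_lt_d9]
    _ = _ := by
        rw [logDivSqrtPrimitive, logDivSqrtPrimitive, Real.sqrt_mul (by norm_num),
          Real.log_mul (by norm_num) (by positivity)]
        field_simp

lemma logDivSqrtPrimitive_nonneg {x : ℝ} (hx : 1 ≤ x) : 0 ≤ logDivSqrtPrimitive x := by
  have := Real.log_nonneg hx
  unfold logDivSqrtPrimitive
  positivity

lemma logDivSqrtPrimitive_le {x : ℝ} (hx : 1 ≤ x) : logDivSqrtPrimitive x ≤ 19 / 2 := by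
  have hlog := Real.log_le_sub_one_of_pos (by positivity : 0 < √x)
  rw [Real.log_sqrt (by positivity)] at hlog
  have := Real.one_le_sqrt.2 hx
  rw [logDivSqrtPrimitive, div_le_iff₀ (by positivity)]
  linarith

lemma sum_logDivSqrt_two_pow_mul_le {x : ℝ} (hx : 1 ≤ x) (J : ℕ) :
    ∑ j ∈ range J, logDivSqrt (2 ^ j * x) ≤ 19 / 2 := by
  have hpow : ∀ j : ℕ, 1 ≤ 2 ^ j * x := fun j => one_le_mul_of_one_le_of_one_le
    (one_le_pow₀ one_le_two) hx
  calc ∑ j ∈ range J, logDivSqrt (2 ^ j * x)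
      ≤ ∑ j ∈ range J,
          (logDivSqrtPrimitive (2 ^ j * x) - logDivSqrtPrimitive (2 ^ (j + 1) * x)) := by
        gcongr with j
        rw [pow_succ', mul_assoc]
        exact logDivSqrt_le_primitive_sub (hpow j)
    _ = logDivSqrtPrimitive (2 ^ 0 * x) - logDivSqrtPrimitive (2 ^ J * x) :=
        sum_range_sub' (fun j => logDivSqrtPrimitive (2 ^ j * x)) J
    _ ≤ 19 / 2 := by
        linarith [logDivSqrtPrimitive_le (hpow 0), logDivSqrtPrimitive_nonneg (hpow J)]

lemma sum_logDivSqrt_div_two_pow_le {N J : ℕ} (hJ : 2 ^ J ≤ N) :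
    ∑ j ∈ range (J + 1), logDivSqrt (N / (2 ^ j : ℕ)) ≤ 19 / 2 := by
  have hx : (1 : ℝ) ≤ N / 2 ^ J := by
    rw [one_le_div (by positivity)]
    exact_mod_cast hJ
  refine le_of_eq_of_le ?_ (sum_logDivSqrt_two_pow_mul_le hx (J + 1))
  rw [← sum_range_reflect]
  refine sum_congr rfl fun j hj => ?_
  have hj' : j ≤ J := Nat.lt_succ_iff.1 (mem_range.1 hj)
  rw [Nat.add_sub_cancel, Nat.cast_pow, Nat.cast_ofNat, mul_div_assoc', mul_comm,
    ← mul_div_mul_right (N : ℝ) _ (pow_ne_zero j two_ne_zero), ← pow_add, Nat.sub_add_cancel hj']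

lemma sum_Ioc_one_two_pow {β : Type*} [AddCommMonoid β] (F : ℕ → β) (J : ℕ) :
    ∑ n ∈ Ioc 1 (2 ^ J), F n = ∑ j ∈ range J, ∑ n ∈ Ioc (2 ^ j) (2 * 2 ^ j), F n := by
  induction J with
  | zero => simp
  | succ J ih =>
    rw [sum_range_succ, ← ih, pow_succ', sum_Ioc_consecutive _ Nat.one_le_two_pow (by omega)]

lemma sum_prime_eq_sum_dyadic {β : Type*} [AddCommMonoid β] {F : ℕ → β} {N J : ℕ}
    (hJ : N < 2 ^ J) (hF : ∀ p, N < p → F p = 0) :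
    ∑ p ∈ Icc 1 N with p.Prime, F p
      = ∑ j ∈ range J, ∑ p ∈ Ioc (2 ^ j) (2 * 2 ^ j) with p.Prime, F p := by
  simp only [sum_filter]
  rw [← sum_Ioc_one_two_pow fun p => if p.Prime then F p else 0, ← sum_filter, ← sum_filter]
  refine sum_subset (fun p hp => ?_) fun p hp hpN => hF p ?_
  · obtain ⟨hp, hprime⟩ := mem_filter.1 hp
    exact mem_filter.2 ⟨mem_Ioc.2 ⟨hprime.one_lt, (mem_Icc.1 hp).2.trans hJ.le⟩, hprime⟩
  · obtain ⟨-, hprime⟩ := mem_filter.1 hp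
    by_contra! hle
    exact hpN (mem_filter.2 ⟨mem_Icc.2 ⟨hprime.one_le, hle⟩, hprime⟩)

lemma norm_sum_prime_le {N q : ℕ} {a : ℤ} {α R B : ℝ} (haq : IsCoprime a (q : ℤ))
    (hα : |α - a / q| ≤ 1 / (q : ℝ) ^ 2) (hR : 1 ≤ R) (hRq : R ≤ q) (hqR : q * R ≤ N)
    {f : ℕ → ℂ} (hf : ∀ n, ‖f n‖ ≤ B) :
    ‖∑ p ∈ Icc 1 N with p.Prime, ∑ m ∈ Icc 1 (N / p), f p * Real.log p * f m * e (m * (p * α))‖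
      ≤ B ^ 2 * N * (2907 + (Real.log N / Real.log 2 + 1) * (304 * logDivSqrt R)) := by
  have hN : 1 ≤ (N : ℝ) := hqR.trans' (one_le_mul_of_one_le_of_one_le (hR.trans hRq) hR)
  have hN₀ : N ≠ 0 := by rintro rfl; norm_num at hN
  set J := Nat.log 2 N
  have hJlog : ((J + 1 : ℕ) : ℝ) ≤ Real.log N / Real.log 2 + 1 := by
    have := Real.natLog_le_logb N 2
    push_cast
    exact add_le_add_left this 1
  have hJN : 2 ^ J ≤ N := Nat.pow_log_le_self 2 hN₀
  have hR_nonneg := logDivSqrt_nonneg hR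
  rw [sum_prime_eq_sum_dyadic (Nat.lt_pow_succ_log_self one_lt_two N) fun p hp => by
    rw [Nat.div_eq_of_lt hp, Icc_eq_empty_of_lt one_pos, sum_empty]]
  calc _ ≤ ∑ j ∈ range (J + 1), B ^ 2 * N * (2 * logDivSqrt ((2 ^ j : ℕ) : ℝ)
          + 304 * logDivSqrt R + 304 * logDivSqrt (N / (2 ^ j : ℕ))) := by
        refine norm_sum_le_of_le _ fun j hj => norm_sum_prime_block_le haq hα hR hRq hqR
          Nat.one_le_two_pow (hJN.trans' (Nat.pow_le_pow_right two_pos ?_)) hf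
        exact Nat.lt_succ_iff.1 (mem_range.1 hj)
    _ = B ^ 2 * N * (2 * ∑ j ∈ range (J + 1), logDivSqrt ((2 ^ j : ℕ) : ℝ)
          + ((J + 1 : ℕ) : ℝ) * (304 * logDivSqrt R)
          + 304 * ∑ j ∈ range (J + 1), logDivSqrt (N / (2 ^ j : ℕ))) := by
        rw [← mul_sum, sum_add_distrib, sum_add_distrib, ← mul_sum, ← mul_sum, sum_const,
          card_range, nsmul_eq_mul, mul_left_comm 304, ← mul_sum]
    _ ≤ B ^ 2 * N * (2 * (19 / 2) + (Real.log N / Real.log 2 + 1) * (304 * logDivSqrt R)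
          + 304 * (19 / 2)) := by
        gcongr
        · simpa using sum_logDivSqrt_two_pow_mul_le le_rfl (J + 1)
        · exact sum_logDivSqrt_div_two_pow_le hJN
    _ = _ := by ring

end Bilinear

section LogWeights

open ArithmeticFunction (vonMangoldt)

lemma sum_log_sub_log_le (N : ℕ) : ∑ n ∈ Icc 1 N, (Real.log N - Real.log n) ≤ N := by
  have hfactorial : ∑ n ∈ Icc 1 N, Real.log n = Real.log N.factorial := by
    rw [← prod_Ico_id_eq_factorial, Ico_add_one_right_eq_Icc, Nat.cast_prod, Real.log_prod]
    exact fun n hn => Nat.cast_ne_zero.2 (Nat.one_le_iff_ne_zero.1 (mem_Icc.1 hn).1)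
  rcases N.eq_zero_or_pos with rfl | hN
  · simp
  have hexp := Real.log_le_log (by positivity)
    (Real.pow_div_factorial_le_exp (N : ℝ) N.cast_nonneg N)
  rw [Real.log_div (by positivity) (by positivity), Real.log_pow, Real.log_exp] at hexp
  rwa [sum_sub_distrib, hfactorial, sum_const, Nat.card_Icc, nsmul_eq_mul, Nat.add_sub_cancel]

lemma log_add_one_div_sq_le {x : ℝ} (hx : 1 ≤ x) :
    Real.log (x + 1) / (x + 1) ^ 2
      ≤ (Real.log x + 2) / x - (Real.log (x + 1) + 2) / (x + 1) := by
  have hx₀ : 0 < x := by positivity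
  have hlog : Real.log (x + 1) - 1 / x ≤ Real.log x := by
    have := Real.log_le_sub_one_of_pos (by positivity : 0 < (x + 1) / x)
    rw [Real.log_div (by positivity) hx₀.ne', add_div, div_self hx₀.ne'] at this
    linarith
  have hlog_nonneg := Real.log_nonneg (by linarith : 1 ≤ x + 1)
  have : 0 ≤ x - 1 := sub_nonneg.2 hx
  have hgap : 0 ≤ (Real.log (x + 1) * x + (x + 1) * (x - 1)) / (x ^ 2 * (x + 1) ^ 2) := by
    positivity
  calc Real.log (x + 1) / (x + 1) ^ 2
      ≤ Real.log (x + 1) / (x + 1) ^ 2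
          + (Real.log (x + 1) * x + (x + 1) * (x - 1)) / (x ^ 2 * (x + 1) ^ 2) :=
        le_add_of_nonneg_right hgap
    _ = (Real.log (x + 1) - 1 / x + 2) / x - (Real.log (x + 1) + 2) / (x + 1) := by
        field_simp
        ring
    _ ≤ _ := by gcongr

lemma sum_log_div_sq_le {N : ℕ} (hN : 1 ≤ N) :
    ∑ n ∈ Icc 1 N, Real.log n / (n : ℝ) ^ 2 ≤ 2 - (Real.log N + 2) / N := by
  induction N, hN using Nat.le_induction with
  | base => norm_num
  | succ N hN ih =>
    have := log_add_one_div_sq_le (by exact_mod_cast hN : (1 : ℝ) ≤ N)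
    rw [sum_Icc_succ_top (by omega), Nat.cast_add_one]
    linarith

lemma sum_prime_log_div_sq_le (N : ℕ) :
    ∑ p ∈ Icc 1 N with p.Prime, Real.log p / (p : ℝ) ^ 2 ≤ 2 := by
  rcases N.eq_zero_or_pos with rfl | hN
  · simp
  have hsubset := sum_le_sum_of_subset_of_nonneg (filter_subset Nat.Prime (Icc 1 N))
    fun p _ _ => div_nonneg (Real.log_natCast_nonneg p) (sq_nonneg (p : ℝ))
  have : 0 ≤ (Real.log N + 2) / N := by
    have := Real.log_natCast_nonneg N
    positivity
  linarith [sum_log_div_sq_le hN]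

lemma sum_geometric_Ico_two_le {x : ℝ} (hx : 0 ≤ x) (hx' : x ≤ 1 / 2) (K : ℕ) :
    ∑ k ∈ Ico 2 K, x ^ k ≤ 2 * x ^ 2 := by
  refine (geom_sum_Ico_le_of_lt_one hx (by linarith)).trans ?_
  rw [div_le_iff₀ (by linarith)]
  nlinarith [sq_nonneg x]

lemma sum_vonMangoldt_div_not_prime_le (N : ℕ) :
    ∑ d ∈ Icc 1 N with ¬ d.Prime, vonMangoldt d / d ≤ 4 := by
  calc ∑ d ∈ Icc 1 N with ¬ d.Prime, vonMangoldt d / d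
      = ∑ d ∈ Icc 1 N with ¬ d.Prime ∧ IsPrimePow d, vonMangoldt d / d := by
        rw [← filter_filter]
        exact (sum_filter_of_ne fun d _ hd =>
          ArithmeticFunction.vonMangoldt_ne_zero_iff.1 (div_ne_zero_iff.1 hd).1).symm
    _ ≤ ∑ x ∈ {p ∈ Icc 1 N | p.Prime} ×ˢ Ico 2 (N + 1), Real.log x.1 * (1 / (x.1 : ℝ)) ^ x.2 := by
        refine sum_le_sum_of_forall_exists (fun x => x.1 ^ x.2)
          (fun x _ => mul_nonneg (Real.log_natCast_nonneg _) (by positivity)) fun d hd => ?_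
        simp only [mem_filter, mem_Icc] at hd
        obtain ⟨⟨-, hdN⟩, hprime, hpow⟩ := hd
        obtain ⟨p, k, hp, hk, rfl⟩ := (isPrimePow_nat_iff d).1 hpow
        have hk₁ : k ≠ 1 := by
          rintro rfl
          exact hprime (by rwa [pow_one])
        have hkN : k ≤ N := (Nat.lt_pow_self hp.one_lt).le.trans hdN
        have hpN : p ≤ N := (Nat.le_self_pow hk.ne' p).trans hdN
        refine ⟨(p, k), ?_, rfl, ?_⟩
        · simp only [mem_product, mem_filter, mem_Icc, mem_Ico]
          exact ⟨⟨⟨hp.one_le, hpN⟩, hp⟩, by omega, by omega⟩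
        · rw [ArithmeticFunction.vonMangoldt_apply_pow hk.ne',
            ArithmeticFunction.vonMangoldt_apply_prime hp, Nat.cast_pow, one_div_pow, mul_one_div]
    _ = ∑ p ∈ Icc 1 N with p.Prime, Real.log p * ∑ k ∈ Ico 2 (N + 1), (1 / (p : ℝ)) ^ k := by
        simp only [sum_product, mul_sum]
    _ ≤ ∑ p ∈ Icc 1 N with p.Prime, Real.log p * (2 * (1 / (p : ℝ)) ^ 2) := by
        gcongr with p hp
        refine sum_geometric_Ico_two_le (by positivity) (one_div_le_one_div_of_le two_pos ?_) _
        exact_mod_cast (mem_filter.1 hp).2.two_le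
    _ = 2 * ∑ p ∈ Icc 1 N with p.Prime, Real.log p / (p : ℝ) ^ 2 := by
        rw [mul_sum]
        exact sum_congr rfl fun p _ => by rw [one_div_pow]; ring
    _ ≤ 4 := by linarith [sum_prime_log_div_sq_le N]

lemma sum_filter_dvd {β : Type*} [AddCommMonoid β] (F : ℕ → β) (N : ℕ) {d : ℕ} (hd : 0 < d) :
    ∑ n ∈ Icc 1 N with d ∣ n, F n = ∑ m ∈ Icc 1 (N / d), F (d * m) := by
  refine sum_nbij' (· / d) (d * ·) (fun n hn => ?_) (fun m hm => ?_) (fun n hn => ?_)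
    (fun m _ => Nat.mul_div_cancel_left m hd) fun n hn => ?_
  · obtain ⟨hn, hdn⟩ := mem_filter.1 hn
    have hn' := mem_Icc.1 hn
    exact mem_Icc.2 ⟨Nat.div_pos (Nat.le_of_dvd hn'.1 hdn) hd, Nat.div_le_div_right hn'.2⟩
  · obtain ⟨hm, hmN⟩ := mem_Icc.1 hm
    rw [Nat.le_div_iff_mul_le hd, mul_comm] at hmN
    exact mem_filter.2 ⟨mem_Icc.2 ⟨Nat.mul_pos hd hm, hmN⟩, dvd_mul_right d m⟩
  · exact Nat.mul_div_cancel' (mem_filter.1 hn).2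
  · rw [Nat.mul_div_cancel' (mem_filter.1 hn).2]

lemma sum_mul_log_eq_sum_vonMangoldt (F : ℕ → ℂ) (N : ℕ) :
    ∑ n ∈ Icc 1 N, F n * Real.log n
      = ∑ d ∈ Icc 1 N, vonMangoldt d * ∑ m ∈ Icc 1 (N / d), F (d * m) := by
  have hlog : ∀ n ∈ Icc 1 N, F n * Real.log n = ∑ d ∈ n.divisors, vonMangoldt d * F n :=
    fun n _ => by
      rw [← ArithmeticFunction.vonMangoldt_sum, ← sum_mul, ← Complex.ofReal_sum, mul_comm]
  rw [sum_congr rfl hlog, sum_comm' (t' := Icc 1 N) (s' := fun d => {n ∈ Icc 1 N | d ∣ n})]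
  · refine sum_congr rfl fun d hd => ?_
    rw [sum_filter_dvd _ N (mem_Icc.1 hd).1, mul_sum]
  · intro n d
    simp only [mem_Icc, mem_filter, Nat.mem_divisors]
    refine ⟨fun ⟨hn, hdn, _⟩ => ⟨⟨hn, hdn⟩, Nat.pos_of_dvd_of_pos hdn hn.1,
      (Nat.le_of_dvd hn.1 hdn).trans hn.2⟩, fun ⟨⟨hn, hdn⟩, _⟩ => ⟨hn, hdn, by omega⟩⟩

lemma norm_sum_mul_log_sub_log_le {F : ℕ → ℂ} {B : ℝ} (hF : ∀ n, ‖F n‖ ≤ B) (N : ℕ) :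
    ‖∑ n ∈ Icc 1 N, F n * (Real.log N - Real.log n : ℝ)‖ ≤ B * N := by
  calc _ ≤ ∑ n ∈ Icc 1 N, B * (Real.log N - Real.log n) := by
        refine norm_sum_le_of_le _ fun n hn => ?_
        obtain ⟨hn, hnN⟩ := mem_Icc.1 hn
        have hlog : 0 ≤ Real.log N - Real.log n :=
          sub_nonneg.2 (Real.log_le_log (by positivity) (by exact_mod_cast hnN))
        rw [norm_mul, Complex.norm_of_nonneg hlog]
        exact mul_le_mul_of_nonneg_right (hF n) hlog
    _ ≤ B * N := by
        rw [← mul_sum]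
        exact mul_le_mul_of_nonneg_left (sum_log_sub_log_le N) ((norm_nonneg _).trans (hF 0))

lemma norm_sum_vonMangoldt_not_prime_le {F : ℕ → ℂ} {B : ℝ} (hF : ∀ n, ‖F n‖ ≤ B) (N : ℕ) :
    ‖∑ d ∈ Icc 1 N with ¬ d.Prime, vonMangoldt d * ∑ m ∈ Icc 1 (N / d), F (d * m)‖
      ≤ 4 * B * N := by
  have hB : 0 ≤ B := (norm_nonneg _).trans (hF 0)
  calc _ ≤ ∑ d ∈ Icc 1 N with ¬ d.Prime, vonMangoldt d * (N / d * B) := by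
        refine norm_sum_le_of_le _ fun d _ => ?_
        rw [norm_mul, Complex.norm_of_nonneg ArithmeticFunction.vonMangoldt_nonneg]
        refine mul_le_mul_of_nonneg_left ?_ ArithmeticFunction.vonMangoldt_nonneg
        calc _ ≤ ∑ _m ∈ Icc 1 (N / d), B := norm_sum_le_of_le _ fun _ _ => hF _
          _ = (N / d : ℕ) * B := by simp
          _ ≤ N / d * B := mul_le_mul_of_nonneg_right Nat.cast_div_le hB
    _ = B * N * ∑ d ∈ Icc 1 N with ¬ d.Prime, vonMangoldt d / d := by
        rw [mul_sum]
        exact sum_congr rfl fun d _ => by ring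
    _ ≤ B * N * 4 := mul_le_mul_of_nonneg_left (sum_vonMangoldt_div_not_prime_le N) (by positivity)
    _ = _ := by ring

lemma BoundedMultiplicative.one_le {f : ArithmeticFunction ℂ} {B : ℝ}
    (hf : BoundedMultiplicative B f) : 1 ≤ B := by
  simpa [hf.1.map_one] using hf.2 1

lemma norm_sum_prime_defect_le {f : ArithmeticFunction ℂ} {B : ℝ}
    (hf : BoundedMultiplicative B f) (N : ℕ) (α : ℝ) :
    ‖∑ p ∈ Icc 1 N with p.Prime, ∑ m ∈ Icc 1 (N / p),
        (f (p * m) - f p * f m) * Real.log p * e (m * (p * α))‖ ≤ 4 * B ^ 2 * N := by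
  have hB := hf.one_le
  have hdefect : ∀ p m : ℕ, p.Prime → ‖f (p * m) - f p * f m‖ ≤ if p ∣ m then 2 * B ^ 2 else 0 :=
    fun p m hp => by
      split_ifs with hpm
      · calc _ ≤ ‖f (p * m)‖ + ‖f p‖ * ‖f m‖ := (norm_sub_le _ _).trans_eq (by rw [norm_mul])
          _ ≤ B + B * B := by
              gcongr
              exacts [hf.2 _, hf.2 _, hf.2 _]
          _ ≤ 2 * B ^ 2 := by nlinarith
      · rw [hf.1.map_mul_of_coprime (hp.coprime_iff_not_dvd.2 hpm), sub_self, norm_zero]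
  calc _ ≤ ∑ p ∈ Icc 1 N with p.Prime, 2 * B ^ 2 * N * (Real.log p / (p : ℝ) ^ 2) := by
        refine norm_sum_le_of_le _ fun p hp => ?_
        have hp := (mem_filter.1 hp).2
        have hlog := Real.log_natCast_nonneg p
        calc _ ≤ ∑ m ∈ Icc 1 (N / p), if p ∣ m then 2 * B ^ 2 * Real.log p else 0 := by
              refine norm_sum_le_of_le _ fun m _ => ?_
              rw [norm_mul, norm_e, mul_one, norm_mul, Complex.norm_of_nonneg hlog, ← ite_zero_mul]
              exact mul_le_mul_of_nonneg_right (hdefect p m hp) hlog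
          _ = (N / p / p : ℕ) * (2 * B ^ 2 * Real.log p) := by
              rw [← sum_filter, sum_filter_dvd _ _ hp.pos]
              simp
          _ ≤ (N / p / p) * (2 * B ^ 2 * Real.log p) := by
              gcongr
              exact Nat.cast_div_le.trans (by gcongr; exact Nat.cast_div_le)
          _ = _ := by ring
    _ ≤ 2 * B ^ 2 * N * 2 := by
        rw [← mul_sum]
        exact mul_le_mul_of_nonneg_left (sum_prime_log_div_sq_le N) (by positivity)
    _ = _ := by ring

lemma sum_prime_mul_log_eq_defect_add (f : ℕ → ℂ) (N : ℕ) (α : ℝ) :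
    ∑ p ∈ Icc 1 N with p.Prime, vonMangoldt p * ∑ m ∈ Icc 1 (N / p),
        f (p * m) * e ((p * m : ℕ) * α)
      = ∑ p ∈ Icc 1 N with p.Prime, ∑ m ∈ Icc 1 (N / p),
          (f (p * m) - f p * f m) * Real.log p * e (m * (p * α))
        + ∑ p ∈ Icc 1 N with p.Prime, ∑ m ∈ Icc 1 (N / p),
          f p * Real.log p * f m * e (m * (p * α)) := by
  simp only [mul_sum, ← sum_add_distrib]
  refine sum_congr rfl fun p hp => sum_congr rfl fun m _ => ?_
  rw [ArithmeticFunction.vonMangoldt_apply_prime (mem_filter.1 hp).2]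
  push_cast
  rw [mul_left_comm (m : ℝ), ← mul_assoc (p : ℝ)]
  ring

lemma norm_S_mul_log_le {f : ArithmeticFunction ℂ} {B : ℝ} (hf : BoundedMultiplicative B f)
    (N : ℕ) (α : ℝ) :
    ‖S f N α‖ * Real.log N ≤ 9 * B ^ 2 * N
      + ‖∑ p ∈ Icc 1 N with p.Prime, ∑ m ∈ Icc 1 (N / p),
          f p * Real.log p * f m * e (m * (p * α))‖ := by
  set F : ℕ → ℂ := fun n => f n * e (n * α) with hFdef
  have hF : ∀ n, ‖F n‖ ≤ B := fun n => by
    rw [hFdef, norm_mul, norm_e, mul_one]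
    exact hf.2 n
  have hsplit : ∑ n ∈ Icc 1 N, F n * Real.log n
      = ∑ p ∈ Icc 1 N with p.Prime, vonMangoldt p * ∑ m ∈ Icc 1 (N / p), F (p * m)
        + ∑ d ∈ Icc 1 N with ¬ d.Prime, vonMangoldt d * ∑ m ∈ Icc 1 (N / d), F (d * m) := by
    rw [sum_mul_log_eq_sum_vonMangoldt, sum_filter_add_sum_filter_not]
  have hlog : S f N α * Real.log N
      = ∑ n ∈ Icc 1 N, F n * (Real.log N - Real.log n : ℝ) + ∑ n ∈ Icc 1 N, F n * Real.log n := by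
    rw [S, sum_mul, ← sum_add_distrib]
    refine sum_congr rfl fun n _ => ?_
    push_cast
    ring
  rw [← Complex.norm_of_nonneg (Real.log_natCast_nonneg N), ← norm_mul, hlog,
    hsplit, sum_prime_mul_log_eq_defect_add]
  have hB₂ : B * N ≤ B ^ 2 * N := by
    gcongr
    exact le_self_pow₀ hf.one_le two_ne_zero
  have hdefect := norm_sum_prime_defect_le hf N α
  have hpowers := norm_sum_vonMangoldt_not_prime_le hF N
  refine (norm_add_le_of_le (norm_sum_mul_log_sub_log_le hF N) (norm_add_le_of_le
    (norm_add_le_of_le hdefect le_rfl) hpowers)).trans ?_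
  linarith

end LogWeights

section ExplicitBound

variable {B α R : ℝ} {f : ArithmeticFunction ℂ} {N q : ℕ} {a : ℤ}

lemma norm_S_le (hf : BoundedMultiplicative B f) (N : ℕ) (α : ℝ) : ‖S f N α‖ ≤ B ^ 2 * N := by
  calc ‖S f N α‖ ≤ ∑ _n ∈ Icc 1 N, B := norm_sum_le_of_le _ fun n _ => by
        rw [norm_mul, norm_e, mul_one]
        exact hf.2 n
    _ = B * N := by simp [mul_comm]
    _ ≤ B ^ 2 * N := by
        gcongr
        exact le_self_pow₀ hf.one_le two_ne_zero

lemma natCast_le_log_of_pow_le {n : ℕ} {x : ℝ} (h : 2.7182818286 ^ n ≤ x) :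
    (n : ℝ) ≤ Real.log x := by
  rw [Real.le_log_iff_exp_le (lt_of_lt_of_le (by positivity) h), ← Real.exp_one_pow]
  exact (pow_le_pow_left₀ (Real.exp_pos 1).le Real.exp_one_lt_d9.le n).trans h

lemma sixteen_le_log_of_lt_sqrt (hR : 1 ≤ R)
    (h : 110 * ((1 + Real.log R) * √(1 + Real.log R)) < √R) : 16 ≤ Real.log R := by
  have hlog := Real.log_nonneg hR
  have hcube : 12100 * (1 + Real.log R) ^ 3 ≤ R :=
    calc 12100 * (1 + Real.log R) ^ 3 = (110 * ((1 + Real.log R) * √(1 + Real.log R))) ^ 2 := by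
          rw [mul_pow, mul_pow, Real.sq_sqrt (by positivity)]
          ring
      _ ≤ √R ^ 2 := pow_le_pow_left₀ (by positivity) h.le 2
      _ = R := Real.sq_sqrt (by positivity)
  have hnine : 9 ≤ Real.log R := by
    have : 1 ^ 3 ≤ (1 + Real.log R) ^ 3 := by gcongr; linarith
    exact_mod_cast natCast_le_log_of_pow_le (n := 9) (x := R) (by norm_num; linarith)
  have : 10 ^ 3 ≤ (1 + Real.log R) ^ 3 := by gcongr; linarith
  exact_mod_cast natCast_le_log_of_pow_le (n := 16) (x := R) (by norm_num; linarith)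

lemma norm_S_mul_log_le_logDivSqrt (hf : BoundedMultiplicative B f)
    (haq : IsCoprime a (q : ℤ)) (hα : |α - a / q| ≤ 1 / (q : ℝ) ^ 2) (hR : 1 ≤ R)
    (hRq : R ≤ q) (hqR : q * R ≤ N) :
    ‖S f N α‖ * Real.log N
      ≤ B ^ 2 * N * (2916 + (Real.log N / Real.log 2 + 1) * (304 * logDivSqrt R)) := by
  linarith [norm_S_mul_log_le hf N α, norm_sum_prime_le haq hα hR hRq hqR hf.2]

lemma logDivSqrt_bilinear_le (hN : 3000 ≤ Real.log N) (hR : 16 ≤ Real.log R) :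
    (Real.log N / Real.log 2 + 1) * (304 * logDivSqrt R)
      ≤ 110 * ((1 + Real.log R) * √(1 + Real.log R)) / √R * Real.log N := by
  have hsqrt : 4 ≤ √(1 + Real.log R) := Real.le_sqrt_of_sq_le (by linarith)
  have hlog_div : 304 * (Real.log N / Real.log 2 + 1) ≤ 440 * Real.log N := by
    have : Real.log N / Real.log 2 ≤ 1.443 * Real.log N := by
      rw [div_le_iff₀ (Real.log_pos one_lt_two)]
      nlinarith [Real.log_two_gt_d9]
    linarith
  calc _ = 304 * (Real.log N / Real.log 2 + 1) * ((1 + Real.log R) / √R) := by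
        rw [logDivSqrt]
        ring
    _ ≤ 440 * Real.log N * ((1 + Real.log R) / √R) := by gcongr
    _ = 110 * ((1 + Real.log R) * 4) / √R * Real.log N := by ring
    _ ≤ _ := by gcongr

lemma norm_S_le_of_isCoprime (hf : BoundedMultiplicative B f)
    (haq : IsCoprime a (q : ℤ)) (hα : |α - a / q| ≤ 1 / (q : ℝ) ^ 2) (hR : 1 < R)
    (hRq : R ≤ q) (hqR : q * R ≤ N) :
    ‖S f N α‖ ≤ B ^ 2 * N *
      (3000 / Real.log N + 110 * ((1 + Real.log R) * √(1 + Real.log R)) / √R) := by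
  have hlogR := Real.log_pos hR
  have hN : (1 : ℝ) < N := by nlinarith
  have hlogN := Real.log_pos hN
  have hsR : 0 < √R := by positivity
  rcases le_or_gt (Real.log N) 3000 with hsmall | hlogN_large
  · refine (norm_S_le hf N α).trans (le_mul_of_one_le_right (by positivity) ?_)
    exact ((one_le_div hlogN).2 hsmall).trans (le_add_of_nonneg_right (by positivity))
  rcases le_or_gt √R (110 * ((1 + Real.log R) * √(1 + Real.log R))) with hsmall | hR_large
  · refine (norm_S_le hf N α).trans (le_mul_of_one_le_right (by positivity) ?_)
    exact ((one_le_div hsR).2 hsmall).trans (le_add_of_nonneg_left (by positivity))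
  rw [← mul_le_mul_iff_left₀ hlogN, mul_assoc, add_mul, div_mul_cancel₀ _ hlogN.ne']
  refine (norm_S_mul_log_le_logDivSqrt hf haq hα hR.le hRq hqR).trans ?_
  gcongr ?_ * (?_ + ?_)
  · norm_num
  · exact logDivSqrt_bilinear_le hlogN_large.le (sixteen_le_log_of_lt_sqrt hR.le hR_large)

end ExplicitBound

section Constants

variable {B E R q : ℝ}

lemma one_le_tprod_oddPrimeFactor :
    1 ≤ ∏' p : {p : ℕ // p.Prime ∧ 2 < p}, oddPrimeFactor p := by
  refine ge_of_tendsto' multipliable_oddPrimeFactor.hasProd fun s => one_le_prod fun p _ => ?_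
  have hp : (3 : ℝ) ≤ (p : ℕ) := by exact_mod_cast p.2.2
  have hdenom : 0 ≤ ((p : ℕ) : ℝ) * ((p - 2) * (p + 1)) := by
    have : (0 : ℝ) ≤ (p : ℕ) - 2 := by linarith
    positivity
  rw [oddPrimeFactor]
  exact le_add_of_nonneg_right (one_div_nonneg.2 (by linarith))

lemma le_z : 11.3 ≤ z := by
  have hsqrt : 1.4125 ≤ √(2 * ∏' p : {p : ℕ // p.Prime ∧ 2 < p}, oddPrimeFactor p) :=
    Real.le_sqrt_of_sq_le (by linarith [one_le_tprod_oddPrimeFactor])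
  rw [z]
  linarith

lemma le_c₁ (hB : 1 ≤ B) (hE : Real.exp 1 ≤ E) (hR : 1 ≤ R) : 3000 * B ^ 2 ≤ c₁ B E R := by
  have hz := le_z
  have hE' : 2.718 ≤ E := le_trans (by linarith [Real.exp_one_gt_d9]) hE
  have hlog := Real.log_nonneg hR
  have hb₁ : 500 * B ^ 2 ≤ b₁ B E := by
    have hcoeff : 500 ≤ 9.82 + 8.12 * (1.59 + z) * E + 18.9 * (z * 0.96) + 3.46 * 1.59
        + 4.06 * z := by
      nlinarith
    calc 500 * B ^ 2 ≤ (9.82 + 8.12 * (1.59 + z) * E + 18.9 * (z * 0.96) + 3.46 * 1.59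
          + 4.06 * z) * B ^ 2 := by gcongr
      _ = b₁ B E - B := by
          rw [b₁, a₁, a₃, a₄]
          ring
      _ ≤ b₁ B E := by linarith
  have hmain : 3000 * B ^ 2 ≤ (1 + 2 * Real.pi) * b₁ B E := by
    nlinarith [Real.pi_gt_three, sq_nonneg B]
  exact hmain.trans (le_add_of_nonneg_right (by positivity))

lemma log_le_add_mul_sqrt {x : ℝ} (hx : 0 < x) (c : ℝ) :
    Real.log x ≤ 2 * (c - 1) + 2 * Real.exp (-c) * √x := by
  have h := Real.log_le_sub_one_of_pos (by positivity : 0 < Real.exp (-c) * √x)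
  rw [Real.log_mul (by positivity) (by positivity), Real.log_exp, Real.log_sqrt hx.le] at h
  linarith

lemma neg_sqrt_div_le_log_ratio (hE : 0 < E) (hq : 1 ≤ Real.log q) :
    -(√E / 27) ≤ 1 + (Real.log (64 / E) + 1) / Real.log q := by
  have hexp : Real.exp (-4) ≤ 1 / 54 := by
    rw [Real.exp_neg, inv_eq_one_div]
    refine one_div_le_one_div_of_le (by norm_num) ?_
    calc (54 : ℝ) ≤ 2.7182818283 ^ 4 := by norm_num
      _ ≤ Real.exp 1 ^ 4 := pow_le_pow_left₀ (by norm_num) Real.exp_one_gt_d9.le 4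
      _ = Real.exp 4 := by rw [Real.exp_one_pow]; norm_num
  have hlogE : Real.log E ≤ 6 + √E / 27 :=
    calc Real.log E ≤ 2 * (4 - 1) + 2 * Real.exp (-4) * √E := log_le_add_mul_sqrt hE 4
      _ ≤ 2 * (4 - 1) + 2 * (1 / 54) * √E := by gcongr
      _ = 6 + √E / 27 := by ring
  have hlog64 : 4 ≤ Real.log 64 := by
    rw [show (64 : ℝ) = 2 ^ 6 by norm_num, Real.log_pow]
    norm_num
    linarith [Real.log_two_gt_d9]
  have hratio : -(1 + √E / 27) ≤ (Real.log (64 / E) + 1) / Real.log q := by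
    rw [le_div_iff₀ (by linarith), Real.log_div (by norm_num) hE.ne']
    nlinarith [Real.sqrt_nonneg E]
  linarith

lemma rpow_three_halves {x : ℝ} (hx : 0 < x) : x ^ (3 / 2 : ℝ) = x * √x := by
  rw [Real.sqrt_eq_rpow, ← Real.rpow_one_add' hx.le (by norm_num)]
  norm_num

lemma log_four_mul_div_rpow_le {x : ℝ} (hx : 2 ≤ Real.log x) :
    Real.log (4 * x) / Real.log x ^ (3 / 2 : ℝ) ≤ 1.25 := by
  have hx₀ : x ≠ 0 := by
    rintro rfl
    norm_num at hx
  have hlog₀ : 0 < Real.log x := by linarith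
  have hlog4 : Real.log 4 ≤ 1.4 := by
    rw [show (4 : ℝ) = 2 ^ 2 by norm_num, Real.log_pow]
    linarith [Real.log_two_lt_d9]
  have hsqrt : 1.4 ≤ √(Real.log x) := Real.le_sqrt_of_sq_le (by linarith)
  rw [rpow_three_halves hlog₀, div_le_iff₀ (by positivity), Real.log_mul (by norm_num) hx₀]
  nlinarith

lemma neg_sq_le_b₃_fst (B : ℝ) (hE : 0 < E) (hER : 2 ≤ Real.log (E * R))
    (hq : 1 ≤ Real.log q) :
    -(0.4 * B ^ 2) ≤ B ^ 2 * (7.63 / √E)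
      * (Real.log (4 * E * R) / Real.log (E * R) ^ (3 / 2 : ℝ))
      * (1 + (Real.log (64 / E) + 1) / Real.log q) := by
  have hX := log_four_mul_div_rpow_le hER
  have hX₀ : 0 ≤ Real.log (4 * (E * R)) / Real.log (E * R) ^ (3 / 2 : ℝ) := by
    have hER₀ : E * R ≠ 0 := by
      intro h
      norm_num [h] at hER
    rw [Real.log_mul (by norm_num) hER₀]
    have := Real.log_nonneg (by norm_num : (1 : ℝ) ≤ 4)
    positivity
  rw [mul_assoc 4 E R]
  set X := Real.log (4 * (E * R)) / Real.log (E * R) ^ (3 / 2 : ℝ)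
  calc -(0.4 * B ^ 2) ≤ -(B ^ 2 * (7.63 / 27 * 1.25)) := by nlinarith [sq_nonneg B]
    _ ≤ -(B ^ 2 * (7.63 / 27 * X)) := by gcongr
    _ = B ^ 2 * (7.63 / √E) * X * -(√E / 27) := by field_simp
    _ ≤ _ := mul_le_mul_of_nonneg_left (neg_sqrt_div_le_log_ratio hE hq) (by positivity)

lemma le_b₃ (B : ℝ) (hE : 0 < E) (hER : 2 ≤ Real.log (E * R)) (hR : 1 ≤ R)
    (hq : 1 ≤ Real.log q) : 15.2 * B ^ 2 ≤ b₃ B E R q := by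
  have hz := le_z
  have hfst := neg_sq_le_b₃_fst B hE hER hq
  have : 0 < Real.log (E * R) := by linarith
  have hlog2R : 0 ≤ Real.log (2 * R) := Real.log_nonneg (by linarith)
  have : 0 ≤ Real.log 2 := Real.log_nonneg one_le_two
  have ha₅ : 15.6 * B ^ 2 ≤ a₅ B * 1.48 := by
    rw [a₅]
    nlinarith [sq_nonneg B]
  have ha₅₀ : 0 ≤ a₅ B := by rw [a₅]; positivity
  have ha₆₀ : 0 ≤ a₆ B := by rw [a₆]; positivity
  have hrest : 0 ≤ 1.48 * (a₆ B / √(Real.log (E * R)))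
      + a₅ B / Real.log 2 * (Real.log (2 * R) / Real.log (E * R) ^ (3 / 2 : ℝ))
      + a₆ B / Real.log 2 * (1 / Real.log (E * R) ^ (3 / 2 : ℝ)) := by positivity
  rw [b₃]
  linarith

lemma le_c₂ (B : ℝ) (hE : 0 < E) (hER : 2 ≤ Real.log (E * R)) (hR : Real.exp 1 < R)
    (hq : 1 ≤ Real.log q) : 110 * B ^ 2 ≤ c₂ B E R q := by
  have hz := le_z
  have hR₁ : 1 ≤ R := (Real.one_le_exp zero_le_one).trans hR.le
  have hlogR : 1 < Real.log R := (Real.lt_log_iff_exp_lt (by linarith)).2 hR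
  have hloglogR := Real.log_pos hlogR
  have : 0 ≤ Real.log 2 := Real.log_nonneg one_le_two
  have : 0 ≤ Real.log (E * R) := by linarith
  have hb₂ : 0 ≤ b₂ B E := by rw [b₂, a₂]; positivity
  calc 110 * B ^ 2 ≤ (1 + 2 * Real.pi) * (15.2 * B ^ 2) := by
        nlinarith [Real.pi_gt_d2, sq_nonneg B]
    _ ≤ (1 + 2 * Real.pi) * b₃ B E R q := by
        gcongr
        exact le_b₃ B hE hER hR₁ hq
    _ ≤ c₂ B E R q := by
        rw [c₂]
        gcongr
        exact le_add_of_nonneg_left (by positivity)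

end Constants

end MontgomeryVaughan

theorem corollary1_general (B : ℝ)
    (f : ArithmeticFunction ℂ) (hf : MontgomeryVaughan.BoundedMultiplicative B f)
    (N q : ℕ) (a : ℤ) (α E R : ℝ)
    (hα : |α - (a : ℝ) / (q : ℝ)| ≤ 1 / (q : ℝ) ^ 2)
    (haq : IsCoprime a (q : ℤ))
    (hE : Real.exp 1 ≤ E) (hR : Real.exp 1 < R)
    (hRq : R ≤ (q : ℝ)) (hqN : (q : ℝ) ≤ (N : ℝ) / R) :
    ‖MontgomeryVaughan.S f N α‖ ≤
      MontgomeryVaughan.c₁ B E R * ((N : ℝ) / Real.log N)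
        + MontgomeryVaughan.c₂ B E R q *
            ((N : ℝ) * Real.log (E * R) ^ (3 / 2 : ℝ) / √R) := by
  have he : 0 < Real.exp 1 := Real.exp_pos 1
  have hR₁ : 1 < R := (Real.one_lt_exp_iff.2 one_pos).trans hR
  have hlogE : 1 ≤ Real.log E := (Real.le_log_iff_exp_le (he.trans_le hE)).2 hE
  have hlogR : 1 ≤ Real.log R := (Real.le_log_iff_exp_le (he.trans hR)).2 hR.le
  have hlogq : 1 ≤ Real.log q := hlogR.trans (Real.log_le_log (he.trans hR) hRq)
  have hlogER : Real.log (E * R) = Real.log E + Real.log R :=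
    Real.log_mul (he.trans_le hE).ne' (he.trans hR).ne'
  have hc₁ := MontgomeryVaughan.le_c₁ hf.one_le hE hR₁.le
  have hc₂ := MontgomeryVaughan.le_c₂ B (he.trans_le hE) (by linarith) hR hlogq
  have hc₂₀ : 0 ≤ MontgomeryVaughan.c₂ B E R q := le_trans (by positivity) hc₂
  calc _ ≤ _ := MontgomeryVaughan.norm_S_le_of_isCoprime hf haq hα hR₁ hRq
        ((le_div_iff₀ (he.trans hR)).1 hqN)
    _ = 3000 * B ^ 2 * (N / Real.log N) + 110 * B ^ 2 *
          (N * (1 + Real.log R) ^ (3 / 2 : ℝ) / √R) := by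
        rw [MontgomeryVaughan.rpow_three_halves (by linarith)]
        ring
    _ ≤ _ := by
        have : 1 + Real.log R ≤ Real.log (E * R) := by linarith
        gcongr

theorem corollary1 (B : ℝ) (hB : 1 ≤ B)
    (f : ArithmeticFunction ℂ) (hf : MontgomeryVaughan.BoundedMultiplicative B f)
    (N q : ℕ) (a : ℤ) (α E R : ℝ)
    (hα : |α - (a : ℝ) / (q : ℝ)| ≤ 1 / (q : ℝ) ^ 2)
    (haq : IsCoprime a (q : ℤ))
    (hE : 4 ≤ E) (hER : Real.exp 3 / E ≤ R)
    (hR : Real.exp 1 < R)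
    (hRq : R ≤ (q : ℝ)) (hqN : (q : ℝ) ≤ (N : ℝ) / R) :
    ‖MontgomeryVaughan.S f N α‖ ≤
      MontgomeryVaughan.c₁ B E R * ((N : ℝ) / Real.log N)
        + MontgomeryVaughan.c₂ B E R q *
            ((N : ℝ) * Real.log (E * R) ^ (3 / 2 : ℝ) / √R) :=
  corollary1_general B f hf N q a α E R hα haq
    (le_trans (by linarith [Real.exp_one_lt_d9]) hE) hR hRq hqN
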